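/- **Setting.** Let $\nu>0$, $b\ge 0$, $a,c\in\mathbb R$, and put $x_0^2=a^2+4\nu b$. Let $k_m,\omega_m\ge 0$, and assume that $x_0^2+4\nu^2k_m^2\neq 0$ or $\omega_m\neq 0$. For real $\omega,k$, for $p\in\mathbb C$ and $L>0$ put $$z(\omega,k)=\sqrt{x_0^2+4\nu\bigl(\nu k^2+i(\omega+ck)\bigr)},\qquad \rho(\omega,k,p,L)=\frac{p-z(\omega,k)}{p+z(\omega,k)}\,e^{-Lz(\omega,k)/(2\nu)}$$ (principal square root; $|\rho|=+\infty$ at a pole). This is the convergence factor, with Robin transmission conditions and overlap $L$, of the Schwarz waveform relaxation algorithm for $\partial_tu+(a,c)\cdot\nabla u-\nu\Delta u+bu=f$. For $h,\Delta t>0$ let $$D=\{(\omega,k):\ \omega_m\le|\omega|\le \tfrac{\pi}{\Delta t},\ k_m\le|k|\le\tfrac{\pi}{h}\},\qquad D^\infty=\{(\omega,k):\ \omega_m\le|\omega|,\ k_m\le|k|\}.$$ The Robin min-max problem on a domain $E$ ($E=D$ or $E=D^\infty$) asks for $p\in\mathbb C$ attaining $\inf_{p\in\mathbb C}\sup_{(\omega,k)\in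 E}|\rho(\omega,k,p,L)|$. Let $$\varphi(k,\xi)=2\sqrt2\,\sqrt{\sqrt{(x_0^2+4\nu^2k^2)^2+16\nu^2\xi^2}+x_0^2+4\nu^2k^2},$$ $$\bar k=|c|\,\frac{\sqrt{(c^2+x_0^2)^2+16\nu^2\omega_m^2}-(c^2+x_0^2)}{8\nu^2\omega_m}\quad(\bar k=0\text{ if }\omega_m=0),$$ $$A=\begin{cases}\varphi(\bar k,-\omega_m+|c|\bar k)&\text{if }k_m\le\bar k,\\ \varphi(k_m,-\omega_m+|c|k_m)&\text{if }\bar k\le k_m\text{ and }|c|k_m\le\omega_m,\\ \varphi(k_m,0)&\text{if }|c|k_m\ge\omega_m\text{ and }k_m\geq\bar k.\end{cases}$$ **Theorem (Robin conditions with overlap, discrete).** For all sufficiently small $L>0$ the Robin min-max problem on $D^\infty$ has a unique solution; it is real and is denoted $p^*_{0,\infty}(L)$. Now let $h$, $\Delta t$, $L$ depend on a parameter along which $h\to0^+$, $\Delta t\to0^+$ and $L\sim C_Lh$ for a constant $C_L>0$. Then, eventually along the parameter, the Robin min-max problem on $D$ with overlap $L$ has a unique solution $p_0^*(L)$ among all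 complex numbers, and it is real. Let $\delta_0^*(L)$ denote the value of the infimum. * If $\Delta t\sim C_hh^2$ for some constant $C_h>0$, then $p_0^*(L)\sim p^*_{0,\infty}(L)$. * If $\Delta t\sim C_hh$ for some constant $C_h>0$, then $p_0^*(L)\sim p^*_{0,\infty}(L)/\sqrt[3]{2}$. In both cases $1-\delta_0^*(L)\sim\dfrac{A}{2p_0^*(L)}$. (Here $u\sim v$ means $u-v=o(v)$.) -/

import Mathlib

open Filter Topology Asymptotics
open scoped ENNReal

noncomputable section

namespace SchwarzWR

/-- The coefficients of the operator `∂ₜ u + (a, c) · ∇u - ν Δu + b u` in two space dimensions. -/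
structure Coeffs where
  ν : ℝ
  a : ℝ
  b : ℝ
  c : ℝ

namespace Coeffs

variable (d : Coeffs)

/-- `x₀² = a² + 4 ν b`. -/
def x0sq : ℝ := d.a ^ 2 + 4 * d.ν * d.b

/-- The symbol `ν k² + i (ω + c k)` of `∂ₜ + c ∂_y - ν ∂_yy`. -/
def symb (ω k : ℝ) : ℂ :=
  ((d.ν * k ^ 2 : ℝ) : ℂ) + Complex.I * ((ω + d.c * k : ℝ) : ℂ)

/-- `z = √(x₀² + 4 ν (ν k² + i (ω + c k)))`, principal square root. -/
def z (ω k : ℝ) : ℂ :=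
  ((d.x0sq : ℂ) + 4 * (d.ν : ℂ) * d.symb ω k) ^ (1 / 2 : ℂ)

/-- `s = p + q (ν k² + i (ω + c k))`. -/
def s (ω k : ℝ) (p q : ℂ) : ℂ := p + q * d.symb ω k

/-- The convergence factor `ρ(ω, k, p, q, L) = (s - z) / (s + z) * exp (-L z / (2 ν))`. -/
def rho (ω k : ℝ) (p q : ℂ) (L : ℝ) : ℂ :=
  (d.s ω k p q - d.z ω k) / (d.s ω k p q + d.z ω k)
    * Complex.exp (-((L : ℂ) * d.z ω k / (2 * (d.ν : ℂ))))

/-- The modulus of the convergence factor as an extended nonnegative number;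
it is `∞` at a pole `s + z = 0`. -/
def absRho (ω k : ℝ) (p q : ℂ) (L : ℝ) : ℝ≥0∞ :=
  ‖d.s ω k p q - d.z ω k‖ₑ / ‖d.s ω k p q + d.z ω k‖ₑ
    * ‖Complex.exp (-((L : ℂ) * d.z ω k / (2 * (d.ν : ℂ))))‖ₑ

/-- Away from the poles, `absRho` is the modulus of `rho`. -/
theorem absRho_eq (ω k : ℝ) (p q : ℂ) (L : ℝ) (h : d.s ω k p q + d.z ω k ≠ 0) :
    d.absRho ω k p q L = ‖d.rho ω k p q L‖ₑ := by
  have key : ∀ A B : ℂ, B ≠ 0 → ‖A / B‖ₑ = ‖A‖ₑ / ‖B‖ₑ := fun A B hB => by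
    rw [div_eq_mul_inv, enorm_mul, enorm_inv hB, ← div_eq_mul_inv]
  rw [absRho, rho, enorm_mul, key _ _ h]

/-- `sup_{(ω, k) ∈ D} |ρ(ω, k, p, 0, L)|`: Robin transmission conditions are `q = 0`. -/
def robinSup (D : Set (ℝ × ℝ)) (L : ℝ) (p : ℂ) : ℝ≥0∞ :=
  ⨆ w ∈ D, d.absRho w.1 w.2 p 0 L

/-- `inf_{p ∈ ℂ} sup_{(ω, k) ∈ D} |ρ(ω, k, p, 0, L)|`. -/
def robinInf (D : Set (ℝ × ℝ)) (L : ℝ) : ℝ≥0∞ := ⨅ p : ℂ, d.robinSup D L p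

/-- The optimized convergence factor `δ₀*(L)` on `D`, as a real number. -/
def robinDelta (D : Set (ℝ × ℝ)) (L : ℝ) : ℝ := (d.robinInf D L).toReal

/-- `p` is a solution of the Robin min-max problem on `D` with overlap `L`. -/
def IsRobinSol (D : Set (ℝ × ℝ)) (L : ℝ) (p : ℂ) : Prop :=
  d.robinSup D L p = d.robinInf D L

/-- `p` is a solution, and the only one among all complex numbers. -/
def IsUniqueRobinSol (D : Set (ℝ × ℝ)) (L : ℝ) (p : ℂ) : Prop :=
  d.IsRobinSol D L p ∧ ∀ p' : ℂ, d.IsRobinSol D L p' → p' = p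

/-- `k̄`; for `ωm = 0` its value is `0`, which is the limit as `ωm → 0`. -/
def kbar (ωm : ℝ) : ℝ :=
  |d.c| * ((√((d.c ^ 2 + d.x0sq) ^ 2 + 16 * d.ν ^ 2 * ωm ^ 2) - (d.c ^ 2 + d.x0sq))
    / (8 * d.ν ^ 2 * ωm))

/-- The function `φ(k, ξ)`. -/
def phi (k ξ : ℝ) : ℝ :=
  2 * √2 * √(√((d.x0sq + 4 * d.ν ^ 2 * k ^ 2) ^ 2 + 16 * d.ν ^ 2 * ξ ^ 2)
    + d.x0sq + 4 * d.ν ^ 2 * k ^ 2)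

open Classical in
/-- The constant `A`. The condition `km ≤ ωm / |c|` is written `|c| km ≤ ωm`, so that it holds
when `c = 0`. -/
def constA (ωm km : ℝ) : ℝ :=
  if km ≤ d.kbar ωm then d.phi (d.kbar ωm) (-ωm + |d.c| * d.kbar ωm)
  else if |d.c| * km ≤ ωm then d.phi km (-ωm + |d.c| * km)
  else d.phi km 0

end Coeffs

/-- `D`: the frequencies `ωm ≤ |ω| ≤ π / Δt`, `km ≤ |k| ≤ π / h` seen by the grid. -/
def freqDomain (ωm km h Δt : ℝ) : Set (ℝ × ℝ) :=
  {w | ωm ≤ |w.1| ∧ |w.1| ≤ Real.pi / Δt ∧ km ≤ |w.2| ∧ |w.2| ≤ Real.pi / h}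

/-- `D^∞`: all frequencies with `ωm ≤ |ω|`, `km ≤ |k|`. -/
def freqDomainInf (ωm km : ℝ) : Set (ℝ × ℝ) :=
  {w | ωm ≤ |w.1| ∧ km ≤ |w.2|}

end SchwarzWR

end

/-! ### The square root `z`: its real and imaginary parts. -/

namespace SchwarzWR

namespace Coeffs

variable (d : Coeffs)

/-! Write `z = x + iy`, with `x > 0` and `|y| ≤ x` on the frequencies considered. For real `p > 0`,
`|ρ|² = (1 - 4px / ((p+x)² + y²)) exp(-Lx/ν)`, so up to higher order `1 - |ρ|²` is the decay
exponent `4px / ((p+x)² + y²) + Lx/ν`. The optimal `p` makes the smallest value of this exponent as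
large as possible.

Solvability. For fixed `z` and `r < 1`, the set `‖p - z‖ ≤ r ‖p + z‖` is a strictly convex disc. A
bounded sublevel set together with lower semicontinuity gives a minimizer. The domain is invariant
under `w ↦ -w`, which conjugates `z`, so the conjugate of a solution is a solution. The midpoint of
two distinct solutions, if real, would be strictly better; applied to `p` and its conjugate this
gives reality, and then uniqueness (`exists_isUniqueRobinSol`).

Low frequencies. The smallest `x` is `m = A/4` (`exists_isMin_re`), and there the exponent is about
`4m/p`. The minimization reduces to the sign of a quadratic polynomial in `k`.

High frequencies. If `|z|² ≈ κx²`, the exponent is about `4p/(κx) + Lx/ν`, minimal at `x² =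
4pν/(κL)` with value `4 √(pL/(κν))`. Equating this with `4m/p` gives `P³ L = κ m² ν`, with the
interior maximum of `|ρ|` at `x = 2P²/(κm)`. Always `|z|² ≤ 2x²`, and `κ = 2` is reached when `|ω|`
may be of order `x²`, that is `L^(-4/3)`. This holds on the unbounded domain and when `Δt ∼ Ch h²`.
If `Δt ∼ Ch h`, then `|ω + ck|` is at most of order `1/L`, so `y` is negligible there and `κ = 1`.
This change of `κ` is the factor `∛2`.

Asymptotics. The parameter `P` bounds `δ²` from above (`robinSup_equiParam_le`). Evaluating `ρ` at
the optimal `p` and at just two frequencies, the one of smallest `x` and one near the interior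
maximum, bounds `δ²` from below. These three bounds force `p ∼ P` and `1 - δ ∼ 2m/p`
(`isEquivalent_of_equioscillation`). -/

theorem z_sq (ω k : ℝ) :
    d.z ω k ^ 2 = (d.x0sq : ℂ) + 4 * (d.ν : ℂ) * d.symb ω k := by
  rw [z, show (1 / 2 : ℂ) = ((2 : ℕ) : ℂ)⁻¹ by norm_num]
  exact Complex.cpow_nat_inv_pow _ two_ne_zero

theorem z_re_nonneg (ω k : ℝ) : 0 ≤ (d.z ω k).re := by
  rw [z]
  set s := (d.x0sq : ℂ) + 4 * (d.ν : ℂ) * d.symb ω k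
  by_cases hs : s = 0
  · simp [hs]
  · rw [Complex.cpow_def_of_ne_zero hs, Complex.exp_re]
    have h : (Complex.log s * (1 / 2)).im = s.arg / 2 := by
      simp [Complex.mul_im, Complex.log_im]; ring
    rw [h]
    have h1 := Complex.arg_le_pi s
    have h2 := Complex.neg_pi_lt_arg s
    exact mul_nonneg (Real.exp_pos _).le (Real.cos_nonneg_of_neg_pi_div_two_le_of_le
      (by linarith) (by linarith))

theorem radicand_eq (ω k : ℝ) : (d.x0sq : ℂ) + 4 * (d.ν : ℂ) * d.symb ω k
    = ((d.x0sq + 4 * d.ν ^ 2 * k ^ 2 : ℝ) : ℂ)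
      + ((4 * d.ν * (ω + d.c * k) : ℝ) : ℂ) * Complex.I := by
  rw [symb]; push_cast; ring

theorem radicand_re (ω k : ℝ) : ((d.x0sq : ℂ) + 4 * (d.ν : ℂ) * d.symb ω k).re
    = d.x0sq + 4 * d.ν ^ 2 * k ^ 2 := by
  rw [radicand_eq, Complex.add_re, Complex.re_ofReal_mul, Complex.I_re, Complex.ofReal_re, mul_zero, add_zero]

theorem radicand_im (ω k : ℝ) : ((d.x0sq : ℂ) + 4 * (d.ν : ℂ) * d.symb ω k).im
    = 4 * d.ν * (ω + d.c * k) := by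
  rw [radicand_eq, Complex.add_im, Complex.im_ofReal_mul, Complex.I_im, Complex.ofReal_im, mul_one, zero_add]

theorem z_re_sq_sub_im_sq (ω k : ℝ) :
    (d.z ω k).re ^ 2 - (d.z ω k).im ^ 2 = d.x0sq + 4 * d.ν ^ 2 * k ^ 2 := by
  have h := congrArg Complex.re (d.z_sq ω k)
  simp [pow_two, symb, Complex.mul_re, Complex.mul_im] at h
  linarith [h]

theorem z_re_mul_im (ω k : ℝ) :
    (d.z ω k).re * (d.z ω k).im = 2 * d.ν * (ω + d.c * k) := by
  have h := congrArg Complex.im (d.z_sq ω k)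
  simp [pow_two, symb, Complex.mul_re, Complex.mul_im] at h
  linarith [h]

theorem x0sq_nonneg {d : Coeffs} (hν : 0 < d.ν) (hb : 0 ≤ d.b) : 0 ≤ d.x0sq := by
  unfold x0sq; positivity

/-- The radicand has nonnegative real part, so its argument is never `π` and the principal root
commutes with conjugation. The reality of the optimum rests on this symmetry. -/
theorem z_neg {d : Coeffs} (hν : 0 < d.ν) (hb : 0 ≤ d.b) (ω k : ℝ) :
    d.z (-ω) (-k) = (starRingEnd ℂ) (d.z ω k) := by
  have harg : ((d.x0sq : ℂ) + 4 * (d.ν : ℂ) * d.symb (-ω) (-k))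
      = (starRingEnd ℂ) ((d.x0sq : ℂ) + 4 * (d.ν : ℂ) * d.symb ω k) := by
    apply Complex.ext
    · rw [Complex.conj_re, radicand_re, radicand_re]; ring
    · rw [Complex.conj_im, radicand_im, radicand_im]; ring
  have hne : ((d.x0sq : ℂ) + 4 * (d.ν : ℂ) * d.symb ω k).arg ≠ Real.pi := by
    intro h
    have h0 : 0 ≤ ((d.x0sq : ℂ) + 4 * (d.ν : ℂ) * d.symb ω k).re := by
      rw [radicand_re]; have := x0sq_nonneg hν hb; positivity
    have := (Complex.abs_arg_le_pi_div_two_iff).2 h0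
    rw [h, abs_of_pos Real.pi_pos] at this
    linarith [Real.pi_pos]
  rw [z, z, harg, Complex.conj_cpow _ _ hne, map_div₀, map_one,
    show (starRingEnd ℂ) 2 = 2 from map_ofNat _ 2]

/-- On the frequencies of interest, `z²` lies in the slit plane. -/
theorem radicand_mem_slitPlane {d : Coeffs} (hν : 0 < d.ν) (hb : 0 ≤ d.b)
    {ωm km : ℝ} (hωm : 0 ≤ ωm) (hkm : 0 ≤ km)
    (hnd : d.x0sq + 4 * d.ν ^ 2 * km ^ 2 ≠ 0 ∨ ωm ≠ 0)
    {w : ℝ × ℝ} (hw : w ∈ freqDomainInf ωm km) :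
    (d.x0sq : ℂ) + 4 * (d.ν : ℂ) * d.symb w.1 w.2 ∈ Complex.slitPlane := by
  have h0 := x0sq_nonneg hν hb
  rw [Complex.mem_slitPlane_iff, radicand_re, radicand_im]
  by_contra hcon
  push Not at hcon
  obtain ⟨h1, h2⟩ := hcon
  have hk2 : 0 ≤ 4 * d.ν ^ 2 * w.2 ^ 2 := by positivity
  have hk0 : w.2 = 0 := by
    have : 4 * d.ν ^ 2 * w.2 ^ 2 = 0 := by linarith
    simpa [hν.ne'] using this
  have hx : d.x0sq = 0 := by linarith
  obtain ⟨hω, hk⟩ := hw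
  rw [hk0, abs_zero] at hk
  have hkm0 : km = 0 := le_antisymm hk hkm
  have hω0 : w.1 = 0 := by
    rw [hk0] at h2
    simpa [hν.ne'] using h2
  rw [hω0, abs_zero] at hω
  rcases hnd with hnd | hnd
  · apply hnd; rw [hx, hkm0]; ring
  · exact hnd (le_antisymm hω hωm)

theorem z_re_pos {d : Coeffs} (hν : 0 < d.ν) (hb : 0 ≤ d.b)
    {ωm km : ℝ} (hωm : 0 ≤ ωm) (hkm : 0 ≤ km)
    (hnd : d.x0sq + 4 * d.ν ^ 2 * km ^ 2 ≠ 0 ∨ ωm ≠ 0)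
    {w : ℝ × ℝ} (hw : w ∈ freqDomainInf ωm km) : 0 < (d.z w.1 w.2).re := by
  refine lt_of_le_of_ne (d.z_re_nonneg _ _) fun h => ?_
  have h1 := d.z_re_sq_sub_im_sq w.1 w.2
  have hB : 0 ≤ d.x0sq + 4 * d.ν ^ 2 * w.2 ^ 2 := by
    have := x0sq_nonneg hν hb; positivity
  rw [← h] at h1
  have him : (d.z w.1 w.2).im = 0 := by nlinarith [sq_nonneg (d.z w.1 w.2).im]
  have hz : d.z w.1 w.2 = 0 := Complex.ext h.symm him
  have h2 := d.z_sq w.1 w.2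
  rw [hz] at h2
  have h3 := radicand_mem_slitPlane hν hb hωm hkm hnd hw
  rw [← h2] at h3
  simp at h3

theorem z_im_sq_le {d : Coeffs} (hν : 0 < d.ν) (hb : 0 ≤ d.b) (ω k : ℝ) :
    (d.z ω k).im ^ 2 ≤ (d.z ω k).re ^ 2 := by
  have h1 := d.z_re_sq_sub_im_sq ω k
  have := x0sq_nonneg hν hb
  have : 0 ≤ 4 * d.ν ^ 2 * k ^ 2 := by positivity
  linarith

theorem z_continuousOn {d : Coeffs} (hν : 0 < d.ν) (hb : 0 ≤ d.b)
    {ωm km : ℝ} (hωm : 0 ≤ ωm) (hkm : 0 ≤ km)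
    (hnd : d.x0sq + 4 * d.ν ^ 2 * km ^ 2 ≠ 0 ∨ ωm ≠ 0) :
    ContinuousOn (fun w : ℝ × ℝ => d.z w.1 w.2) (freqDomainInf ωm km) := by
  intro w hw
  apply ContinuousAt.continuousWithinAt
  unfold z
  refine ContinuousAt.cpow ?_ continuousAt_const
    (radicand_mem_slitPlane hν hb hωm hkm hnd hw)
  unfold symb
  fun_prop

/-! ### Bounds for the modulus of the convergence factor. -/

/-- Clearing the denominator covers the pole `p = -z` too: there both sides are false because `z ≠
0`. The condition on `p` becomes an Apollonius disc. -/
theorem absRho_le_iff (L : ℝ) {M : ℝ} (hM : 0 ≤ M) {ω k : ℝ} (hz : d.z ω k ≠ 0) (p : ℂ) :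
    d.absRho ω k p 0 L ≤ ENNReal.ofReal M ↔
      ‖p - d.z ω k‖ ≤ M * Real.exp (L * (d.z ω k).re / (2 * d.ν)) * ‖p + d.z ω k‖ := by
  have hs : d.s ω k p 0 = p := by simp [s]
  have hexp : ‖Complex.exp (-((L : ℂ) * d.z ω k / (2 * (d.ν : ℂ))))‖
      = (Real.exp (L * (d.z ω k).re / (2 * d.ν)))⁻¹ := by
    rw [Complex.norm_exp, ← Real.exp_neg]
    congr 1
    rw [show (2 * (d.ν : ℂ)) = ((2 * d.ν : ℝ) : ℂ) by push_cast; ring, Complex.neg_re,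
      Complex.div_ofReal_re, Complex.re_ofReal_mul]
  rw [absRho, hs]
  by_cases h : p + d.z ω k = 0
  · have hp : p - d.z ω k ≠ 0 := by
      rw [eq_neg_of_add_eq_zero_left h]
      intro h'
      exact hz (by linear_combination (-1 / 2 : ℂ) * h')
    rw [h, enorm_zero, norm_zero, mul_zero, ENNReal.div_zero (by simpa using hp),
      ENNReal.top_mul (by simp)]
    simp [hp]
  · have hpos : 0 < ‖p + d.z ω k‖ := norm_pos_iff.2 h
    rw [← ofReal_norm, ← ofReal_norm, ← ofReal_norm, hexp, ← ENNReal.ofReal_div_of_pos hpos,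
      ← ENNReal.ofReal_mul (by positivity), ENNReal.ofReal_le_ofReal_iff hM, ← div_eq_mul_inv,
      div_le_iff₀ (Real.exp_pos _), div_le_iff₀ hpos]

/-- `|ρ|²` for a real parameter `p`. -/
noncomputable def rhoSq (L p : ℝ) (w : ℝ × ℝ) : ℝ :=
  ((p - (d.z w.1 w.2).re) ^ 2 + (d.z w.1 w.2).im ^ 2)
    / ((p + (d.z w.1 w.2).re) ^ 2 + (d.z w.1 w.2).im ^ 2)
    * Real.exp (-(L * (d.z w.1 w.2).re / d.ν))

theorem absRho_le_iff_rhoSq {d : Coeffs} {L M p : ℝ} (hM : 0 ≤ M) (hp : 0 < p)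
    {w : ℝ × ℝ} (hz : 0 < (d.z w.1 w.2).re) :
    d.absRho w.1 w.2 p 0 L ≤ ENNReal.ofReal M ↔ d.rhoSq L p w ≤ M ^ 2 := by
  have hz0 : d.z w.1 w.2 ≠ 0 := fun h => by simp [h] at hz
  rw [d.absRho_le_iff L hM hz0, ← sq_le_sq₀ (norm_nonneg _) (by positivity), mul_pow, mul_pow,
    Complex.sq_norm, Complex.sq_norm, Complex.normSq_apply, Complex.normSq_apply, rhoSq]
  simp only [Complex.sub_re, Complex.sub_im, Complex.add_re, Complex.add_im, Complex.ofReal_re,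
    Complex.ofReal_im, zero_sub, zero_add]
  have hden : 0 < (p + (d.z w.1 w.2).re) ^ 2 + (d.z w.1 w.2).im ^ 2 := by positivity
  have he : Real.exp (L * (d.z w.1 w.2).re / (2 * d.ν)) ^ 2
      = Real.exp (L * (d.z w.1 w.2).re / d.ν) := by
    rw [← Real.exp_nat_mul]; congr 1; push_cast; field_simp
  rw [he, Real.exp_neg, ← div_eq_mul_inv, div_le_iff₀ (Real.exp_pos _), div_le_iff₀ hden]
  constructor <;> intro h <;> nlinarith [h]

/-- The rational factor is `1 - u` with `u = 4px / ((p+x)² + y²)`, and `1 - u ≤ exp(-u)`. -/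
theorem rhoSq_le_exp {d : Coeffs} (L : ℝ) {p : ℝ} (hp : 0 < p) {w : ℝ × ℝ}
    (hz : 0 < (d.z w.1 w.2).re) :
    d.rhoSq L p w ≤ Real.exp (-(4 * p * (d.z w.1 w.2).re
      / ((p + (d.z w.1 w.2).re) ^ 2 + (d.z w.1 w.2).im ^ 2) + L * (d.z w.1 w.2).re / d.ν)) := by
  rw [rhoSq, neg_add, Real.exp_add]
  gcongr
  have hden : 0 < (p + (d.z w.1 w.2).re) ^ 2 + (d.z w.1 w.2).im ^ 2 := by positivity
  refine le_trans (le_of_eq ?_) (Real.add_one_le_exp _)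
  field_simp
  ring

theorem le_rhoSq {d : Coeffs} (hν : 0 < d.ν) {L p : ℝ} (hL : 0 ≤ L) (hp : 0 < p) {w : ℝ × ℝ}
    (hz : 0 < (d.z w.1 w.2).re) :
    1 - 4 * p * (d.z w.1 w.2).re / ((p + (d.z w.1 w.2).re) ^ 2 + (d.z w.1 w.2).im ^ 2)
      - L * (d.z w.1 w.2).re / d.ν ≤ d.rhoSq L p w := by
  rw [rhoSq]
  set x := (d.z w.1 w.2).re
  set y := (d.z w.1 w.2).im
  have hden : 0 < (p + x) ^ 2 + y ^ 2 := by positivity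
  have h1 : ((p - x) ^ 2 + y ^ 2) / ((p + x) ^ 2 + y ^ 2)
      = 1 - 4 * p * x / ((p + x) ^ 2 + y ^ 2) := by
    field_simp; ring
  have h2 : 0 ≤ ((p - x) ^ 2 + y ^ 2) / ((p + x) ^ 2 + y ^ 2) := by positivity
  have h3 : 0 ≤ 4 * p * x / ((p + x) ^ 2 + y ^ 2) := by positivity
  have h4 : 0 ≤ L * x / d.ν := by positivity
  have h5 := Real.add_one_le_exp (-(L * x / d.ν))
  nlinarith [mul_le_mul_of_nonneg_left h5 h2, mul_nonneg h3 h4]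

end Coeffs

/-! ### Existence, uniqueness and reality of the optimum. -/

/-- Strict convexity of the Apollonius disc `‖p - z‖ ≤ r ‖p + z‖`, `r < 1`. -/
theorem norm_midpoint_sub_lt {z p p' : ℂ} {r : ℝ} (hr : 0 ≤ r) (hr1 : r < 1) (hne : p ≠ p')
    (h : ‖p - z‖ ≤ r * ‖p + z‖) (h' : ‖p' - z‖ ≤ r * ‖p' + z‖) :
    ‖(p + p') / 2 - z‖ < r * ‖(p + p') / 2 + z‖ := by
  rw [← sq_le_sq₀ (norm_nonneg _) (by positivity), mul_pow, Complex.sq_norm, Complex.sq_norm,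
    Complex.normSq_apply, Complex.normSq_apply] at h h'
  rw [← sq_lt_sq₀ (norm_nonneg _) (by positivity), mul_pow, Complex.sq_norm, Complex.sq_norm,
    Complex.normSq_apply, Complex.normSq_apply]
  have hd : 0 < Complex.normSq (p - p') := Complex.normSq_pos.2 (sub_ne_zero.2 hne)
  rw [Complex.normSq_apply] at hd
  have hr2 : 0 < 1 - r ^ 2 := by nlinarith
  have hprod := mul_pos hr2 hd
  simp only [Complex.sub_re, Complex.sub_im, Complex.add_re, Complex.add_im,
    Complex.div_ofNat_re, Complex.div_ofNat_im] at *
  linarith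

theorem norm_ofReal_sub_lt {m : ℝ} (hm : 0 < m) {z : ℂ} (hz : 0 < z.re) :
    ‖(m : ℂ) - z‖ < ‖(m : ℂ) + z‖ := by
  rw [← sq_lt_sq₀ (norm_nonneg _) (norm_nonneg _), Complex.sq_norm, Complex.sq_norm,
    Complex.normSq_apply, Complex.normSq_apply]
  simp only [Complex.sub_re, Complex.sub_im, Complex.add_re, Complex.add_im, Complex.ofReal_re,
    Complex.ofReal_im]
  nlinarith [mul_pos hm hz]

namespace Coeffs

/-- Both `4ν²k²` and `|xy| = 2ν|ω + ck|` are at most `x²`, so bounded `x` confines `k` and then `ω`.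
-/
theorem eventually_le_z_re {d : Coeffs} (hν : 0 < d.ν) (hb : 0 ≤ d.b) (M : ℝ) :
    ∀ᶠ w : ℝ × ℝ in cocompact (ℝ × ℝ), M ≤ (d.z w.1 w.2).re := by
  wlog hM : 0 < M generalizing M
  · filter_upwards with w
    exact (not_lt.1 hM).trans (d.z_re_nonneg _ _)
  set K := M / (2 * d.ν) with hK
  set R := M ^ 2 / (2 * d.ν) + |d.c| * K with hR
  refine mem_cocompact.2 ⟨Set.Icc (-R) R ×ˢ Set.Icc (-K) K, isCompact_Icc.prod isCompact_Icc, ?_⟩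
  intro w hw
  by_contra hlt
  simp only [Set.mem_ofPred_eq, not_le] at hlt
  apply hw
  have hx := d.z_re_nonneg w.1 w.2
  have h1 := d.z_re_sq_sub_im_sq w.1 w.2
  have h2 := d.z_re_mul_im w.1 w.2
  have h3 := z_im_sq_le hν hb w.1 w.2
  have h4 := x0sq_nonneg hν hb
  set x := (d.z w.1 w.2).re
  set y := (d.z w.1 w.2).im
  have hk : |w.2| ≤ K := by
    rw [hK, le_div_iff₀ (by positivity)]
    apply le_of_sq_le_sq _ hM.le
    rw [mul_pow, sq_abs]
    nlinarith [sq_nonneg y]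
  have hxy : |x * y| ≤ M ^ 2 := by
    rw [abs_le]
    constructor <;> nlinarith [sq_nonneg (x - y), sq_nonneg (x + y)]
  have hω : |w.1 + d.c * w.2| ≤ M ^ 2 / (2 * d.ν) := by
    rw [le_div_iff₀ (by positivity)]
    rw [h2, abs_mul, abs_of_pos (by positivity : 0 < 2 * d.ν)] at hxy
    linarith
  have hω' : |w.1| ≤ R := by
    calc |w.1| = |(w.1 + d.c * w.2) - d.c * w.2| := by ring_nf
      _ ≤ |w.1 + d.c * w.2| + |d.c * w.2| := abs_sub _ _
      _ ≤ R := by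
        rw [abs_mul, hR]
        gcongr
  exact ⟨abs_le.1 hω', abs_le.1 hk⟩

theorem robinSup_le_iff {d : Coeffs} {E : Set (ℝ × ℝ)} {L M : ℝ} (hM : 0 ≤ M)
    (hz : ∀ w ∈ E, 0 < (d.z w.1 w.2).re) (p : ℂ) :
    d.robinSup E L p ≤ ENNReal.ofReal M ↔ ∀ w ∈ E,
      ‖p - d.z w.1 w.2‖ ≤ M * Real.exp (L * (d.z w.1 w.2).re / (2 * d.ν))
        * ‖p + d.z w.1 w.2‖ := by
  rw [robinSup, iSup₂_le_iff]
  refine forall₂_congr fun w hw => d.absRho_le_iff L hM (fun h => ?_) p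
  have := hz w hw
  simp [h] at this

theorem robinSup_le_iff_rhoSq {d : Coeffs} {E : Set (ℝ × ℝ)} {L M p : ℝ} (hM : 0 ≤ M)
    (hp : 0 < p) (hz : ∀ w ∈ E, 0 < (d.z w.1 w.2).re) :
    d.robinSup E L p ≤ ENNReal.ofReal M ↔ ∀ w ∈ E, d.rhoSq L p w ≤ M ^ 2 := by
  rw [robinSup, iSup₂_le_iff]
  exact forall₂_congr fun w hw => absRho_le_iff_rhoSq hM hp (hz w hw)

theorem lowerSemicontinuous_robinSup {d : Coeffs} {E : Set (ℝ × ℝ)} (L : ℝ)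
    (hz : ∀ w ∈ E, 0 < (d.z w.1 w.2).re) : LowerSemicontinuous (d.robinSup E L) := by
  unfold robinSup
  refine lowerSemicontinuous_biSup fun w hw => ?_
  rw [lowerSemicontinuous_iff_isClosed_preimage]
  intro y
  have hz0 : d.z w.1 w.2 ≠ 0 := fun h => by
    have := hz w hw
    simp [h] at this
  rcases eq_or_ne y ⊤ with rfl | hy
  · simp
  · rw [← ENNReal.ofReal_toReal hy]
    have : (fun p => d.absRho w.1 w.2 p 0 L) ⁻¹' Set.Iic (ENNReal.ofReal y.toReal)
        = {p | ‖p - d.z w.1 w.2‖ ≤ y.toReal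
            * Real.exp (L * (d.z w.1 w.2).re / (2 * d.ν)) * ‖p + d.z w.1 w.2‖} := by
      ext p
      exact d.absRho_le_iff L ENNReal.toReal_nonneg hz0 p
    rw [this]
    exact isClosed_le (by fun_prop) (by fun_prop)

theorem robinSup_conj {d : Coeffs} (hν : 0 < d.ν) (hb : 0 ≤ d.b) {E : Set (ℝ × ℝ)}
    (hsym : ∀ w ∈ E, -w ∈ E) (hz : ∀ w ∈ E, 0 < (d.z w.1 w.2).re) {L M : ℝ} (hM : 0 ≤ M) {p : ℂ}
    (h : d.robinSup E L p ≤ ENNReal.ofReal M) :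
    d.robinSup E L ((starRingEnd ℂ) p) ≤ ENNReal.ofReal M := by
  rw [robinSup_le_iff hM hz] at h ⊢
  intro w hw
  have h1 := h (-w) (hsym w hw)
  rw [Prod.fst_neg, Prod.snd_neg, z_neg hν hb, Complex.conj_re] at h1
  rw [← Complex.norm_conj, ← Complex.norm_conj ((starRingEnd ℂ) p + d.z w.1 w.2)]
  simpa using h1

/-- Pointwise strict bounds pass to the supremum even on unbounded `E`, since `Re z → ∞` at infinity
and the overlap makes `|ρ|` vanish there. -/
theorem robinSup_lt {d : Coeffs} (hν : 0 < d.ν) (hb : 0 ≤ d.b) {E : Set (ℝ × ℝ)}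
    (hE : IsClosed E) (hne : E.Nonempty)
    (hcont : ContinuousOn (fun w : ℝ × ℝ => d.z w.1 w.2) E)
    (hz : ∀ w ∈ E, 0 < (d.z w.1 w.2).re) {L M m : ℝ} (hL : 0 < L) (hM : 0 ≤ M) (hm : 0 < m)
    (h : ∀ w ∈ E, ‖(m : ℂ) - d.z w.1 w.2‖ < M * Real.exp (L * (d.z w.1 w.2).re / (2 * d.ν))
        * ‖(m : ℂ) + d.z w.1 w.2‖) :
    d.robinSup E L m < ENNReal.ofReal M := by
  obtain ⟨w₀, hw₀⟩ := hne
  have hMpos : 0 < M := by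
    rcases hM.eq_or_lt with h0 | h0
    · have := h w₀ hw₀
      rw [← h0, zero_mul, zero_mul] at this
      exact absurd this (not_lt.2 (norm_nonneg _))
    · exact h0
  have hden : ∀ w ∈ E, 0 < ‖(m : ℂ) + d.z w.1 w.2‖ := fun w hw =>
    lt_of_le_of_lt (norm_nonneg _) (norm_ofReal_sub_lt hm (hz w hw))
  set f : ℝ × ℝ → ℝ := fun w => ‖(m : ℂ) - d.z w.1 w.2‖ / ‖(m : ℂ) + d.z w.1 w.2‖
    * Real.exp (-(L * (d.z w.1 w.2).re / (2 * d.ν))) with hf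
  -- Truncating at `M / 2` makes the function minimal outside a compact set, so a maximum exists
  -- whatever the base point.
  have hfc : ContinuousOn (fun w => max (f w) (M / 2)) E := by
    refine ContinuousOn.sup (ContinuousOn.mul (ContinuousOn.div ?_ ?_ fun w hw => (hden w hw).ne')
      ?_) continuousOn_const
    · exact (continuousOn_const.sub hcont).norm
    · exact (continuousOn_const.add hcont).norm
    · exact Real.continuous_exp.comp_continuousOn
        ((continuousOn_const.mul (Complex.continuous_re.comp_continuousOn hcont)).div_const _).neg
  have hflt : ∀ w ∈ E, f w < M := fun w hw => by
    rw [hf]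
    simp only
    rw [Real.exp_neg, ← div_eq_mul_inv, div_lt_iff₀ (Real.exp_pos _), div_lt_iff₀ (hden w hw)]
    exact h w hw
  obtain ⟨w₁, hw₁, hmax⟩ := hfc.exists_isMaxOn' hE hw₀ (by
    have hev := eventually_le_z_re hν hb (-Real.log (M / 2) * (2 * d.ν) / L)
    filter_upwards [hev.filter_mono inf_le_left, mem_inf_of_right (mem_principal_self E)]
      with w hw hwE
    refine max_le (le_trans ?_ (le_max_right _ _)) (le_max_right _ _)
    have h1 : ‖(m : ℂ) - d.z w.1 w.2‖ / ‖(m : ℂ) + d.z w.1 w.2‖ ≤ 1 :=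
      (div_le_one (hden w hwE)).2 (norm_ofReal_sub_lt hm (hz w hwE)).le
    have h2 : Real.exp (-(L * (d.z w.1 w.2).re / (2 * d.ν))) ≤ M / 2 := by
      rw [← Real.le_log_iff_exp_le (by positivity), neg_le, le_div_iff₀ (by positivity)]
      rw [div_le_iff₀ hL] at hw
      linarith
    calc f w ≤ 1 * (M / 2) := mul_le_mul h1 h2 (Real.exp_pos _).le zero_le_one
      _ = M / 2 := one_mul _)
  refine lt_of_le_of_lt (b := ENNReal.ofReal (max (f w₁) (M / 2))) ?_
    ((ENNReal.ofReal_lt_ofReal_iff hMpos).2 (max_lt (hflt w₁ hw₁) (by linarith)))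
  rw [robinSup_le_iff (le_max_of_le_right (by positivity)) hz]
  intro w hw
  have h1 : f w ≤ max (f w₁) (M / 2) := (le_max_left _ _).trans (hmax hw)
  rw [hf] at h1
  simp only at h1
  rw [Real.exp_neg, ← div_eq_mul_inv, div_le_iff₀ (Real.exp_pos _), div_le_iff₀ (hden w hw)] at h1
  exact h1

/-- Existence, uniqueness and reality of the Robin optimum, as soon as some parameter beats the
damping by the overlap at one frequency. -/
theorem exists_isUniqueRobinSol {d : Coeffs} (hν : 0 < d.ν) (hb : 0 ≤ d.b) {E : Set (ℝ × ℝ)}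
    (hE : IsClosed E) (hsym : ∀ w ∈ E, -w ∈ E)
    (hcont : ContinuousOn (fun w : ℝ × ℝ => d.z w.1 w.2) E)
    (hz : ∀ w ∈ E, 0 < (d.z w.1 w.2).re) {L : ℝ} (hL : 0 < L) {w₀ : ℝ × ℝ} (hw₀ : w₀ ∈ E)
    {p₀ : ℂ} (hp₀ : d.robinSup E L p₀
      < ENNReal.ofReal (Real.exp (-(L * (d.z w₀.1 w₀.2).re / (2 * d.ν))))) :
    ∃ p : ℝ, 0 < p ∧ d.IsUniqueRobinSol E L p := by
  set e := Real.exp (L * (d.z w₀.1 w₀.2).re / (2 * d.ν)) with he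
  have hepos : 0 < e := Real.exp_pos _
  have hbound : ∀ M : ℝ, 0 ≤ M → ENNReal.ofReal M
      < ENNReal.ofReal (Real.exp (-(L * (d.z w₀.1 w₀.2).re / (2 * d.ν)))) → M * e < 1 := by
    intro M hM h
    rw [ENNReal.ofReal_lt_ofReal_iff_of_nonneg hM, Real.exp_neg, ← he] at h
    calc M * e < e⁻¹ * e := by gcongr
      _ = 1 := inv_mul_cancel₀ hepos.ne'
  have hfin₀ : d.robinSup E L p₀ ≠ ⊤ := (hp₀.trans ENNReal.ofReal_lt_top).ne
  -- existence
  obtain ⟨q, hq⟩ : ∃ q : ℂ, ∀ p, d.robinSup E L q ≤ d.robinSup E L p := by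
    set K := {p : ℂ | d.robinSup E L p ≤ d.robinSup E L p₀} with hK
    have hKc : IsClosed K :=
      (lowerSemicontinuous_iff_isClosed_preimage.1 (lowerSemicontinuous_robinSup L hz)) _
    set M := (d.robinSup E L p₀).toReal with hMdef
    have hM : ENNReal.ofReal M = d.robinSup E L p₀ := ENNReal.ofReal_toReal hfin₀
    have hM0 : 0 ≤ M := ENNReal.toReal_nonneg
    have hr := hbound M hM0 (hM ▸ hp₀)
    -- The frequency `w₀` alone confines `p` to an Apollonius disc of ratio `M * e < 1`.
    have hKb : Bornology.IsBounded K := by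
      refine (Metric.isBounded_closedBall (x := (0 : ℂ))
        (r := (1 + M * e) * ‖d.z w₀.1 w₀.2‖ / (1 - M * e))).subset fun p hp => ?_
      rw [mem_closedBall_zero_iff, le_div_iff₀ (by linarith)]
      rw [hK, Set.mem_ofPred_eq, ← hM, robinSup_le_iff hM0 hz] at hp
      have h1 := hp w₀ hw₀
      have h2 : ‖p‖ - ‖d.z w₀.1 w₀.2‖ ≤ ‖p - d.z w₀.1 w₀.2‖ := norm_sub_norm_le _ _
      have h3 := mul_le_mul_of_nonneg_left (norm_add_le p (d.z w₀.1 w₀.2))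
        (by positivity : 0 ≤ M * e)
      linarith
    obtain ⟨q, hqK, hq⟩ := LowerSemicontinuousOn.exists_isMinOn ⟨p₀, by rw [hK, Set.mem_ofPred_eq]⟩
      (Metric.isCompact_of_isClosed_isBounded hKc hKb)
      ((lowerSemicontinuous_robinSup (d := d) L hz).lowerSemicontinuousOn K)
    refine ⟨q, fun p => ?_⟩
    by_cases hp : p ∈ K
    · exact hq hp
    · exact le_trans hqK (le_of_lt (not_le.1 hp))
  have hqinf : d.robinSup E L q = d.robinInf E L :=
    le_antisymm (le_iInf hq) (iInf_le _ _)
  have hlt : d.robinInf E L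
      < ENNReal.ofReal (Real.exp (-(L * (d.z w₀.1 w₀.2).re / (2 * d.ν)))) :=
    lt_of_le_of_lt (iInf_le _ p₀) hp₀
  set δ := d.robinDelta E L with hδ
  have hδ0 : 0 ≤ δ := ENNReal.toReal_nonneg
  have hδeq : ENNReal.ofReal δ = d.robinInf E L :=
    ENNReal.ofReal_toReal (hlt.trans ENNReal.ofReal_lt_top).ne
  have hr := hbound δ hδ0 (hδeq ▸ hlt)
  have hsol : ∀ p, d.IsRobinSol E L p ↔ d.robinSup E L p ≤ ENNReal.ofReal δ := fun p => by
    rw [hδeq]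
    exact ⟨fun h => h.le, fun h => le_antisymm h (iInf_le _ _)⟩
  -- solutions have positive real part
  have hpos : ∀ p, d.IsRobinSol E L p → 0 < p.re := by
    intro p hp
    have h1 := (hsol p).1 hp
    have h2 := robinSup_conj hν hb hsym hz hδ0 h1
    rw [robinSup_le_iff hδ0 hz] at h1 h2
    have h1 := h1 w₀ hw₀
    have h2 := h2 w₀ hw₀
    have hx := hz w₀ hw₀
    have key : ∀ u v : ℂ, ‖u‖ ≤ δ * e * ‖v‖ → u ≠ 0 ∨ v ≠ 0 →
        Complex.normSq u < Complex.normSq v := by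
      intro u v h hne
      have hv : 0 < ‖v‖ := by
        rcases (norm_nonneg v).eq_or_lt with h0 | h0
        · rw [← h0, mul_zero] at h
          have hu := norm_le_zero_iff.1 h
          have hv := norm_eq_zero.1 h0.symm
          exact absurd hne (by simp [hu, hv])
        · exact h0
      rw [Complex.normSq_eq_norm_sq, Complex.normSq_eq_norm_sq]
      have : ‖u‖ < ‖v‖ := lt_of_le_of_lt h (by nlinarith)
      gcongr
    have hnz : ∀ p : ℂ, p - d.z w₀.1 w₀.2 ≠ 0 ∨ p + d.z w₀.1 w₀.2 ≠ 0 := by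
      intro p
      by_contra hcon
      push Not at hcon
      have : d.z w₀.1 w₀.2 = 0 := by linear_combination (hcon.2 - hcon.1) / 2
      simp [this] at hx
    have h1 := key _ _ h1 (hnz _)
    have h2 := key _ _ h2 (hnz _)
    -- The two inequalities say that the inner products of `p` and of its conjugate with `z` are
    -- positive; their sum is `2 Re p Re z`.
    simp only [Complex.normSq_apply, Complex.sub_re, Complex.sub_im, Complex.add_re,
      Complex.add_im, Complex.conj_re, Complex.conj_im] at h1 h2
    by_contra hcon
    nlinarith [mul_nonneg (neg_nonneg.2 (not_lt.1 hcon)) hx.le]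
  -- a real midpoint of two distinct solutions would be strictly better
  have hmid : ∀ p p', d.IsRobinSol E L p → d.IsRobinSol E L p' → (p + p').im = 0 → p = p' := by
    intro p p' hp hp' him
    by_contra hne
    have h1 := (robinSup_le_iff hδ0 hz p).1 ((hsol p).1 hp)
    have h2 := (robinSup_le_iff hδ0 hz p').1 ((hsol p').1 hp')
    set m : ℝ := (p.re + p'.re) / 2 with hm
    have hm0 : 0 < m := by
      have := hpos p hp
      have := hpos p' hp'
      positivity
    have hmeq : (m : ℂ) = (p + p') / 2 := by
      apply Complex.ext
      · simp [hm]
      · rw [Complex.div_ofNat_im, him]; simp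
    have hlt' : d.robinSup E L m < ENNReal.ofReal δ := by
      refine robinSup_lt hν hb hE ⟨w₀, hw₀⟩ hcont hz hL hδ0 hm0 fun w hw => ?_
      -- Where the ratio reaches `1` the disc is no longer convex, but any positive real number lies
      -- strictly inside.
      by_cases hr1 : δ * Real.exp (L * (d.z w.1 w.2).re / (2 * d.ν)) < 1
      · rw [hmeq]
        exact norm_midpoint_sub_lt (by positivity) hr1 hne (h1 w hw) (h2 w hw)
      · refine lt_of_lt_of_le (norm_ofReal_sub_lt hm0 (hz w hw)) ?_
        exact le_mul_of_one_le_left (norm_nonneg _) (not_lt.1 hr1)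
    rw [hδeq] at hlt'
    exact absurd (iInf_le (fun p => d.robinSup E L p) (m : ℂ)) (not_le.2 hlt')
  have hreal : ∀ p, d.IsRobinSol E L p → p.im = 0 := by
    intro p hp
    have hc : d.IsRobinSol E L ((starRingEnd ℂ) p) :=
      (hsol _).2 (robinSup_conj hν hb hsym hz hδ0 ((hsol p).1 hp))
    have := congrArg Complex.im (hmid p _ hp hc (by simp))
    rw [Complex.conj_im] at this
    linarith
  have hqre : ((q.re : ℝ) : ℂ) = q := Complex.ext (by simp) (by simp [hreal q hqinf])
  refine ⟨q.re, hpos q hqinf, ?_⟩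
  rw [hqre]
  exact ⟨hqinf, fun p hp => hmid p q hp hqinf (by rw [Complex.add_im, hreal p hp,
    hreal q hqinf, add_zero])⟩

/-! ### Minimization of `Re z` and the constant `A`. -/

theorem z_re_pow_four (d : Coeffs) (ω k : ℝ) :
    (d.z ω k).re ^ 4 = (d.z ω k).re ^ 2 * (d.x0sq + 4 * d.ν ^ 2 * k ^ 2)
      + 4 * d.ν ^ 2 * (ω + d.c * k) ^ 2 := by
  rw [← z_re_sq_sub_im_sq d ω k]
  have h := congrArg (· ^ 2) (d.z_re_mul_im ω k)
  simp only [mul_pow] at h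
  linear_combination h

/-- Eliminating `Im z` makes `(Re z)²` the larger root of a monic quadratic; the hypothesis says
that this quadratic is nonpositive at `X²`. Lower bounds for `Re z` thus need no square roots. -/
theorem le_z_re {d : Coeffs} (ω k : ℝ) {X : ℝ}
    (h : X ^ 4 ≤ X ^ 2 * (d.x0sq + 4 * d.ν ^ 2 * k ^ 2) + 4 * d.ν ^ 2 * (ω + d.c * k) ^ 2) :
    X ≤ (d.z ω k).re := by
  by_contra hcon
  push Not at hcon
  have h1 := d.z_re_pow_four ω k
  have h2 := d.z_re_sq_sub_im_sq ω k
  have h3 := d.z_re_nonneg ω k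
  set x := (d.z ω k).re
  have hlt : x ^ 2 < X ^ 2 := by gcongr
  have h4 : (X ^ 2 - x ^ 2) * (X ^ 2 + x ^ 2 - (d.x0sq + 4 * d.ν ^ 2 * k ^ 2)) ≤ 0 := by
    linarith
  have h5 : 0 < X ^ 2 + x ^ 2 - (d.x0sq + 4 * d.ν ^ 2 * k ^ 2) := by
    have : 0 ≤ x ^ 2 := sq_nonneg x
    nlinarith [sq_nonneg (d.z ω k).im]
  nlinarith [mul_pos (sub_pos.2 hlt) h5]

theorem phi_eq (d : Coeffs) (ω k : ℝ) : d.phi k (ω + d.c * k) = 4 * (d.z ω k).re := by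
  have h1 := d.z_re_sq_sub_im_sq ω k
  have h2 := d.z_re_mul_im ω k
  have h3 := d.z_re_nonneg ω k
  set x := (d.z ω k).re
  set y := (d.z ω k).im
  have hr : √((d.x0sq + 4 * d.ν ^ 2 * k ^ 2) ^ 2 + 16 * d.ν ^ 2 * (ω + d.c * k) ^ 2)
      = x ^ 2 + y ^ 2 := by
    rw [← Real.sqrt_sq (by positivity : 0 ≤ x ^ 2 + y ^ 2)]
    congr 1
    have h := congrArg (· ^ 2) h2
    simp only [mul_pow] at h
    rw [← h1]
    linear_combination (-4) * h
  rw [phi, hr, add_assoc, ← h1, show x ^ 2 + y ^ 2 + (x ^ 2 - y ^ 2) = 2 * x ^ 2 by ring,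
    Real.sqrt_mul (by norm_num), Real.sqrt_sq h3]
  have := Real.mul_self_sqrt (show (0 : ℝ) ≤ 2 by norm_num)
  linear_combination (2 * x) * this

theorem phi_neg_left (d : Coeffs) (k ξ : ℝ) : d.phi (-k) ξ = d.phi k ξ := by
  simp [phi]

/-- `φ(k, -ωm + |c| k)` is four times the real part of `z` at an admissible frequency. -/
theorem exists_phi_eq (d : Coeffs) {ωm km k : ℝ} (hωm : 0 ≤ ωm) (hk0 : 0 ≤ k) (hk : km ≤ k) :
    ∃ w ∈ freqDomainInf ωm km, d.phi k (-ωm + |d.c| * k) = 4 * (d.z w.1 w.2).re ∧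
      (d.z w.1 w.2).re ^ 4 = (d.z w.1 w.2).re ^ 2 * (d.x0sq + 4 * d.ν ^ 2 * k ^ 2)
        + 4 * d.ν ^ 2 * (ωm - |d.c| * k) ^ 2 := by
  rcases le_total 0 d.c with hc | hc
  · refine ⟨(-ωm, k), ⟨?_, ?_⟩, ?_, ?_⟩
    · simp [abs_of_nonneg hωm]
    · simpa [abs_of_nonneg hk0]
    · rw [abs_of_nonneg hc, phi_eq]
    · rw [abs_of_nonneg hc, d.z_re_pow_four (-ωm) k]; ring
  · refine ⟨(-ωm, -k), ⟨?_, ?_⟩, ?_, ?_⟩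
    · simp [abs_of_nonneg hωm]
    · simpa [abs_of_nonneg hk0]
    · rw [abs_of_nonpos hc, ← phi_neg_left, ← phi_eq, neg_mul_comm]
    · rw [abs_of_nonpos hc, d.z_re_pow_four (-ωm) (-k)]; ring

/-- For given `|k|`, the least `|ω + ck|` is the positive part of `ωm - |c||k|`. Once it vanishes,
the bound only improves with `|k|`, so the smallest such `|k|` suffices. -/
theorem le_z_re_of_forall {d : Coeffs} {ωm km X : ℝ} (hωm : 0 ≤ ωm) (hkm : 0 ≤ km)
    (h1 : ∀ k, km ≤ k → |d.c| * k ≤ ωm → X ^ 4 ≤ X ^ 2 * (d.x0sq + 4 * d.ν ^ 2 * k ^ 2)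
      + 4 * d.ν ^ 2 * (ωm - |d.c| * k) ^ 2)
    (h2 : ωm < |d.c| * km → X ^ 4 ≤ X ^ 2 * (d.x0sq + 4 * d.ν ^ 2 * km ^ 2))
    {w : ℝ × ℝ} (hw : w ∈ freqDomainInf ωm km) : X ≤ (d.z w.1 w.2).re := by
  apply le_z_re
  obtain ⟨hω, hk⟩ := hw
  rw [← sq_abs w.2]
  set k := |w.2| with hkdef
  have hk0 : 0 ≤ k := abs_nonneg _
  have hmono : ∀ k1, 0 ≤ k1 → k1 ≤ k → X ^ 2 * (d.x0sq + 4 * d.ν ^ 2 * k1 ^ 2)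
      ≤ X ^ 2 * (d.x0sq + 4 * d.ν ^ 2 * k ^ 2) + 4 * d.ν ^ 2 * (w.1 + d.c * w.2) ^ 2 := by
    intro k1 hk1 hle
    refine le_add_of_le_of_nonneg ?_ (by positivity)
    gcongr
  by_cases hck : |d.c| * k ≤ ωm
  · refine (h1 k hk hck).trans ?_
    have h3 : ωm - |d.c| * k ≤ |w.1 + d.c * w.2| := by
      have : |w.1| ≤ |w.1 + d.c * w.2| + |d.c * w.2| := by
        calc |w.1| = |(w.1 + d.c * w.2) - d.c * w.2| := by ring_nf
          _ ≤ _ := abs_sub _ _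
      rw [abs_mul] at this
      linarith
    have h4 : (ωm - |d.c| * k) ^ 2 ≤ (w.1 + d.c * w.2) ^ 2 := by
      rw [← sq_abs (w.1 + d.c * w.2)]
      have : 0 ≤ ωm - |d.c| * k := by linarith
      gcongr
    gcongr
  · push Not at hck
    by_cases hcm : |d.c| * km ≤ ωm
    · have hc : 0 < |d.c| := by
        by_contra hc
        have : |d.c| = 0 := le_antisymm (not_lt.1 hc) (abs_nonneg _)
        rw [this, zero_mul] at hck
        linarith
      have h3 := h1 (ωm / |d.c|) ((le_div_iff₀ hc).2 (by linarith))
        (by rw [mul_div_cancel₀ _ hc.ne'])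
      rw [mul_div_cancel₀ _ hc.ne', sub_self] at h3
      refine le_trans ?_ (hmono (ωm / |d.c|) (by positivity)
        ((div_le_iff₀ hc).2 (by linarith)))
      linarith
    · exact (h2 (not_le.1 hcm)).trans (hmono km hkm hk)

theorem kbar_nonneg {d : Coeffs} {ωm : ℝ} (hωm : 0 ≤ ωm) : 0 ≤ d.kbar ωm := by
  unfold kbar
  have h : d.c ^ 2 + d.x0sq
      ≤ √((d.c ^ 2 + d.x0sq) ^ 2 + 16 * d.ν ^ 2 * ωm ^ 2) := by
    apply Real.le_sqrt_of_sq_le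
    have : 0 ≤ 16 * d.ν ^ 2 * ωm ^ 2 := by positivity
    linarith
  have : 0 ≤ √((d.c ^ 2 + d.x0sq) ^ 2 + 16 * d.ν ^ 2 * ωm ^ 2) - (d.c ^ 2 + d.x0sq) := by
    linarith
  positivity

/-- The square `T` of the minimal real part along `|ω| = ωm`, which is reached at `k = k̄`. -/
theorem exists_sq_min {d : Coeffs} (hν : 0 < d.ν) (hb : 0 ≤ d.b) {ωm : ℝ} (hωm : 0 ≤ ωm)
    (hnd : 0 < d.x0sq ∨ 0 < ωm) :
    ∃ T, 0 < T ∧ (T + d.c ^ 2) * d.kbar ωm = |d.c| * ωm ∧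
      T ^ 2 = T * (d.x0sq + 4 * d.ν ^ 2 * d.kbar ωm ^ 2)
        + 4 * d.ν ^ 2 * (ωm - |d.c| * d.kbar ωm) ^ 2 := by
  have hx0 := x0sq_nonneg hν hb
  set R := √((d.c ^ 2 + d.x0sq) ^ 2 + 16 * d.ν ^ 2 * ωm ^ 2) with hR
  have hRsq : R ^ 2 = (d.c ^ 2 + d.x0sq) ^ 2 + 16 * d.ν ^ 2 * ωm ^ 2 :=
    Real.sq_sqrt (by positivity)
  have hR0 : 0 ≤ R := Real.sqrt_nonneg _
  have hRS : d.c ^ 2 + d.x0sq ≤ R := by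
    apply Real.le_sqrt_of_sq_le
    have : 0 ≤ 16 * d.ν ^ 2 * ωm ^ 2 := by positivity
    linarith
  -- This `T` gives the quadratic in `k` of `le_z_re_of_forall` a double root, which is `k̄`: `T +
  -- c²` is the positive root of `Y² = (c² + x₀²) Y + 4ν²ωm²`.
  set T := (d.x0sq - d.c ^ 2 + R) / 2 with hTdef
  have hT : 0 < T := by
    have h : d.c ^ 2 - d.x0sq < R := by
      rcases hnd with h | h
      · linarith
      · apply lt_of_pow_lt_pow_left₀ 2 hR0
        rw [hRsq]
        have : 0 < 16 * d.ν ^ 2 * ωm ^ 2 := by positivity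
        nlinarith [mul_nonneg (sq_nonneg d.c) hx0]
    linarith
  have hY : 0 < T + d.c ^ 2 := by positivity
  have hκ : (T + d.c ^ 2) * d.kbar ωm = |d.c| * ωm := by
    rw [kbar, ← hR, show T + d.c ^ 2 = (d.c ^ 2 + d.x0sq + R) / 2 by rw [hTdef]; ring]
    rcases hωm.eq_or_lt with h | h
    · simp [← h]
    · field_simp
      linear_combination |d.c| * hRsq
  refine ⟨T, hT, hκ, ?_⟩
  set κ := d.kbar ωm
  have hYsq : (T + d.c ^ 2) ^ 2
      = (d.c ^ 2 + d.x0sq) * (T + d.c ^ 2) + 4 * d.ν ^ 2 * ωm ^ 2 := by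
    rw [show T + d.c ^ 2 = (d.c ^ 2 + d.x0sq + R) / 2 by rw [hTdef]; ring]
    linear_combination hRsq / 4
  apply mul_left_cancel₀ hY.ne'
  have hc2 := sq_abs d.c
  have hκ2 : (T + d.c ^ 2) * (|d.c| * κ) = d.c ^ 2 * ωm := by
    rw [← hc2] at hκ ⊢
    linear_combination |d.c| * hκ
  have e1 : T * (d.x0sq + 4 * d.ν ^ 2 * κ ^ 2) + 4 * d.ν ^ 2 * (ωm - |d.c| * κ) ^ 2
      = T * d.x0sq + 4 * d.ν ^ 2 * ωm * (ωm - |d.c| * κ) := by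
    linear_combination 4 * d.ν ^ 2 * κ * hκ + 4 * d.ν ^ 2 * κ ^ 2 * hc2
  rw [e1]
  linear_combination 4 * d.ν ^ 2 * ωm * hκ2 + T * hYsq

/-- The constant `A` is four times the minimum of `Re z` over the unbounded domain. -/
theorem exists_isMin_re {d : Coeffs} (hν : 0 < d.ν) (hb : 0 ≤ d.b) {ωm km : ℝ} (hωm : 0 ≤ ωm)
    (hkm : 0 ≤ km) (hnd : d.x0sq + 4 * d.ν ^ 2 * km ^ 2 ≠ 0 ∨ ωm ≠ 0) :
    ∃ w₁ ∈ freqDomainInf ωm km, d.constA ωm km = 4 * (d.z w₁.1 w₁.2).re ∧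
      ∀ w ∈ freqDomainInf ωm km, (d.z w₁.1 w₁.2).re ≤ (d.z w.1 w.2).re := by
  have hx0 := x0sq_nonneg hν hb
  have hκ0 := kbar_nonneg (d := d) hωm
  rw [constA]
  split_ifs with h1 h2
  · have hnd' : 0 < d.x0sq ∨ 0 < ωm := by
      rcases hωm.eq_or_lt with h | h
      · left
        have hκ : d.kbar ωm = 0 := by simp [kbar, ← h]
        have hk0 : km = 0 := le_antisymm (hκ ▸ h1) hkm
        rcases hnd with hnd | hnd
        · rw [hk0] at hnd
          exact lt_of_le_of_ne hx0 fun h0 => hnd (by rw [← h0]; ring)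
        · exact absurd h.symm hnd
      · exact Or.inr h
    obtain ⟨T, hT, hκ, hTeq⟩ := exists_sq_min hν hb hωm hnd'
    obtain ⟨w₁, hw₁, hphi, hX⟩ := d.exists_phi_eq hωm hκ0 h1
    refine ⟨w₁, hw₁, hphi, fun w hw => ?_⟩
    have hX0 := z_re_pos hν hb hωm hkm hnd hw₁
    have hX2 := d.z_re_sq_sub_im_sq w₁.1 w₁.2
    set X := (d.z w₁.1 w₁.2).re
    set κ := d.kbar ωm
    have hXT : X ^ 2 = T := by
      have h3 : (X ^ 2 - T) * (X ^ 2 + T - (d.x0sq + 4 * d.ν ^ 2 * κ ^ 2)) = 0 := by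
        linear_combination hX - hTeq
      rcases mul_eq_zero.1 h3 with h | h
      · linarith
      · exfalso
        have h4 : X ^ 2 * T + 4 * d.ν ^ 2 * (ωm - |d.c| * κ) ^ 2 = 0 := by
          linear_combination X ^ 2 * h - hX
        have h5 : 0 < X ^ 2 * T := by positivity
        have h6 : 0 ≤ 4 * d.ν ^ 2 * (ωm - |d.c| * κ) ^ 2 := by positivity
        linarith
    refine le_z_re_of_forall hωm hkm (fun k _ _ => ?_) (fun hc => ?_) hw
    · have h3 : X ^ 2 * (d.x0sq + 4 * d.ν ^ 2 * k ^ 2) + 4 * d.ν ^ 2 * (ωm - |d.c| * k) ^ 2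
          - X ^ 4 = 4 * d.ν ^ 2 * (T + d.c ^ 2) * (k - κ) ^ 2 := by
        rw [← hXT] at hκ ⊢
        linear_combination 4 * d.ν ^ 2 * (k ^ 2 - κ ^ 2) * sq_abs d.c
          + 8 * d.ν ^ 2 * (k - κ) * hκ - hX
      have : 0 ≤ 4 * d.ν ^ 2 * (T + d.c ^ 2) * (k - κ) ^ 2 := by positivity
      linarith
    · exfalso
      have h3 : |d.c| * km ≤ |d.c| * κ := by gcongr
      have h4 : (T + d.c ^ 2) * (|d.c| * κ) = d.c ^ 2 * ωm := by
        rw [← sq_abs d.c] at hκ ⊢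
        linear_combination |d.c| * hκ
      nlinarith [mul_pos hT (sub_pos.2 (hc.trans_le h3)), sq_nonneg d.c]
  · push Not at h1
    obtain ⟨w₁, hw₁, hphi, hX⟩ := d.exists_phi_eq hωm hkm le_rfl
    refine ⟨w₁, hw₁, hphi, fun w hw => ?_⟩
    set X := (d.z w₁.1 w₁.2).re with hXdef
    -- The vertex `|c| ωm / (X² + c²)` lies at or left of `km`, so the quadratic increases on `k ≥
    -- km`. For `ωm > 0` this uses `X² ≥ T` and `k̄ ≤ km`.
    have hslope : |d.c| * ωm ≤ (X ^ 2 + d.c ^ 2) * km := by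
      rcases hωm.eq_or_lt with h | h
      · rw [← h, mul_zero]; positivity
      · obtain ⟨T, hT, hκ, hTeq⟩ := exists_sq_min hν hb hωm (Or.inr h)
        have hTX : √T ≤ X := by
          have hT4 : √T ^ 4 = T ^ 2 := by
            rw [show √T ^ 4 = (√T ^ 2) ^ 2 by ring, Real.sq_sqrt hT.le]
          refine le_z_re_of_forall hωm hkm (fun k _ _ => ?_) (fun hc => absurd h2 (not_le.2 hc))
            hw₁
          rw [hT4, Real.sq_sqrt hT.le]
          set κ := d.kbar ωm
          have h3 : T * (d.x0sq + 4 * d.ν ^ 2 * k ^ 2) + 4 * d.ν ^ 2 * (ωm - |d.c| * k) ^ 2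
              - T ^ 2 = 4 * d.ν ^ 2 * (T + d.c ^ 2) * (k - κ) ^ 2 := by
            linear_combination 4 * d.ν ^ 2 * (k ^ 2 - κ ^ 2) * sq_abs d.c
              + 8 * d.ν ^ 2 * (k - κ) * hκ - hTeq
          have : 0 ≤ 4 * d.ν ^ 2 * (T + d.c ^ 2) * (k - κ) ^ 2 := by positivity
          linarith
        have hTX2 : T ≤ X ^ 2 := by
          rw [← Real.sq_sqrt hT.le]
          gcongr
        rw [← hκ]
        gcongr
    refine le_z_re_of_forall hωm hkm (fun k hk _ => ?_) (fun hc => absurd h2 (not_le.2 hc)) hw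
    have h3 : X ^ 2 * (d.x0sq + 4 * d.ν ^ 2 * k ^ 2) + 4 * d.ν ^ 2 * (ωm - |d.c| * k) ^ 2
        - X ^ 4 = 4 * d.ν ^ 2 * ((k - km)
          * ((X ^ 2 + d.c ^ 2) * (k + km) - 2 * (|d.c| * ωm))) := by
      linear_combination 4 * d.ν ^ 2 * (k ^ 2 - km ^ 2) * sq_abs d.c - hX
    have h4 : 0 ≤ (X ^ 2 + d.c ^ 2) * (k + km) - 2 * (|d.c| * ωm) := by
      have : (X ^ 2 + d.c ^ 2) * km ≤ (X ^ 2 + d.c ^ 2) * k := by gcongr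
      linarith
    have : 0 ≤ 4 * d.ν ^ 2 * ((k - km)
          * ((X ^ 2 + d.c ^ 2) * (k + km) - 2 * (|d.c| * ωm))) := by
      have := sub_nonneg.2 hk
      positivity
    linarith
  · push Not at h2
    have hmem : (-(d.c * km), km) ∈ freqDomainInf ωm km := by
      refine ⟨?_, le_abs_self _⟩
      simp only [abs_neg, abs_mul, abs_of_nonneg hkm]
      exact h2.le
    refine ⟨_, hmem, ?_, fun w hw => ?_⟩
    · rw [← phi_eq]; simp
    · have hX := d.z_re_pow_four (-(d.c * km)) km
      refine le_z_re_of_forall hωm hkm (fun k hk hk' => ?_) (fun _ => ?_) hw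
      · exfalso
        have : |d.c| * km ≤ |d.c| * k := by gcongr
        linarith
      · rw [hX]; simp

end Coeffs

/-! ### Closedness and symmetry of the frequency domains. -/

theorem isClosed_freqDomainInf (ωm km : ℝ) : IsClosed (freqDomainInf ωm km) :=
  (isClosed_le continuous_const continuous_fst.abs).inter
    (isClosed_le continuous_const continuous_snd.abs)

theorem isClosed_freqDomain (ωm km h Δt : ℝ) : IsClosed (freqDomain ωm km h Δt) :=
  (isClosed_le continuous_const continuous_fst.abs).inter
    ((isClosed_le continuous_fst.abs continuous_const).inter
      ((isClosed_le continuous_const continuous_snd.abs).inter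
        (isClosed_le continuous_snd.abs continuous_const)))

theorem neg_mem_freqDomainInf {ωm km : ℝ} {w : ℝ × ℝ} (hw : w ∈ freqDomainInf ωm km) :
    -w ∈ freqDomainInf ωm km := by
  obtain ⟨h1, h2⟩ := hw
  exact ⟨by simpa using h1, by simpa using h2⟩

theorem neg_mem_freqDomain {ωm km h Δt : ℝ} {w : ℝ × ℝ} (hw : w ∈ freqDomain ωm km h Δt) :
    -w ∈ freqDomain ωm km h Δt := by
  obtain ⟨h1, h2, h3, h4⟩ := hw
  exact ⟨by simpa using h1, by simpa using h2, by simpa using h3, by simpa using h4⟩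

theorem freqDomain_subset (ωm km h Δt : ℝ) : freqDomain ωm km h Δt ⊆ freqDomainInf ωm km :=
  fun _ hw => ⟨hw.1, hw.2.2.1⟩

/-! ### Equioscillation in scaled variables. -/

/-- Lower bound for the decay exponent of `|ρ|²` at the equioscillating parameter, in the scaled
variables `t = Re z / P`, `s = Im z / P`. -/
theorem le_scaled_exponent {η t s κ K : ℝ} (hη : 0 < η) (hηt : η ≤ t) (hs : s ^ 2 ≤ t ^ 2)
    (hκ : 0 ≤ κ) (hK : 16 ≤ K)
    (hden : 1 ≤ t → 1 ≤ 5 * (η * t) → (1 + t) ^ 2 + s ^ 2 ≤ κ * t ^ 2 + K * t) :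
    4 * η - K * η ^ 2 ≤ 4 * t / ((1 + t) ^ 2 + s ^ 2) + κ * η ^ 2 * t := by
  have ht : 0 < t := hη.trans_le hηt
  have hD : 0 < (1 + t) ^ 2 + s ^ 2 := by positivity
  have hκt : 0 ≤ κ * η ^ 2 * t := by positivity
  rcases le_total t 1 with h1 | h1
  · refine le_trans ?_ (le_add_of_nonneg_right hκt)
    rw [le_div_iff₀ hD]
    have h2 : (1 + t) ^ 2 + s ^ 2 ≤ 1 + 4 * t := by nlinarith
    rcases le_total (4 * η - K * η ^ 2) 0 with h3 | h3
    · exact (mul_nonpos_of_nonpos_of_nonneg h3 hD.le).trans (by positivity)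
    · calc (4 * η - K * η ^ 2) * ((1 + t) ^ 2 + s ^ 2)
          ≤ (4 * η - K * η ^ 2) * (1 + 4 * t) := by gcongr
        _ ≤ (4 * η - 16 * η ^ 2) * (1 + 4 * t) := by gcongr
        _ ≤ 4 * t := by nlinarith [mul_pos hη ht, mul_pos (mul_pos hη hη) ht]
  -- In the middle range the rational term alone exceeds `4η`. The sharp denominator bound is needed
  -- only for `t ≥ 1 / (5η)`, where AM-GM gives `4/u + η²u ≥ 4η` with `u = κt + K`.
  · rcases le_total (5 * (η * t)) 1 with h2 | h2
    · refine le_trans ?_ (le_add_of_nonneg_right hκt)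
      have h3 : 4 * η ≤ 4 * t / ((1 + t) ^ 2 + s ^ 2) := by
        rw [le_div_iff₀ hD]
        have h4 : (1 + t) ^ 2 + s ^ 2 ≤ 5 * t ^ 2 := by nlinarith
        calc 4 * η * ((1 + t) ^ 2 + s ^ 2) ≤ 4 * η * (5 * t ^ 2) := by gcongr
          _ = 4 * t * (5 * (η * t)) := by ring
          _ ≤ 4 * t * 1 := by gcongr
          _ = 4 * t := mul_one _
      have : 0 ≤ K * η ^ 2 := by positivity
      linarith
    · have h3 := hden h1 h2
      have hu : 0 < κ * t + K := by positivity
      have h4 : 4 / (κ * t + K) ≤ 4 * t / ((1 + t) ^ 2 + s ^ 2) := by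
        rw [div_le_div_iff₀ hu hD]
        nlinarith
      have h5 : 4 * η ≤ 4 / (κ * t + K) + η ^ 2 * (κ * t + K) := by
        rw [← sub_nonneg]
        have : 4 / (κ * t + K) + η ^ 2 * (κ * t + K) - 4 * η
            = (η * (κ * t + K) - 2) ^ 2 / (κ * t + K) := by
          field_simp
          ring
        rw [this]
        positivity
      linarith

/-- Equioscillation asymptotics: the optimal parameter `p` and the optimal factor `δ` are
determined by one upper bound for `δ` at `P` and two lower bounds, at the lowest frequency and at
the interior maximum. -/
theorem isEquivalent_of_equioscillation {ι : Type*} {l : Filter ι} {P p δ : ι → ℝ}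
    {m K K' C : ℝ} (hm : 0 < m) (hP : Tendsto P l atTop) (hp : ∀ᶠ i in l, 0 < p i)
    (hδ : ∀ᶠ i in l, 0 ≤ δ i)
    (hU : ∀ᶠ i in l, δ i ^ 2 ≤ Real.exp (-(4 * (m / P i) - K * (m / P i) ^ 2)))
    (hL1 : ∀ᶠ i in l, 1 - 4 * m / p i - K' * (m / P i) ^ 3 ≤ δ i ^ 2)
    (hL2 : ∀ᶠ i in l, 1 - 2 * (m / P i) * (1 + C / P i) * (p i / P i + 1) ≤ δ i ^ 2) :
    p ~[l] P ∧ (fun i => 1 - δ i) ~[l] fun i => 4 * m / (2 * p i) := by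
  have hP0 : ∀ᶠ i in l, 0 < P i := hP.eventually_gt_atTop 0
  have hη : Tendsto (fun i => m / P i) l (𝓝 0) := hP.const_div_atTop m
  have hC : Tendsto (fun i => 1 + C / P i) l (𝓝 1) := by
    simpa using (hP.const_div_atTop C).const_add 1
  -- With `u = p / P`, the three bounds become `1 - o(1) ≤ T`, `T ≤ 1/u + o(1)` and `T ≤ (1 + o(1))
  -- (u + 1) / 2`, which squeeze `u` and then `T` to `1`.
  set T : ι → ℝ := fun i => (1 - δ i ^ 2) / (4 * (m / P i)) with hT
  set lo : ι → ℝ := fun i => (1 - K * (m / P i) / 4)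
    / (1 + (4 * (m / P i) - K * (m / P i) ^ 2)) with hlo
  have hlo1 : Tendsto lo l (𝓝 1) := by
    have h1 : Tendsto (fun i => 1 - K * (m / P i) / 4) l (𝓝 (1 - K * 0 / 4)) :=
      ((hη.const_mul K).div_const 4).const_sub 1
    have h2 : Tendsto (fun i => 1 + (4 * (m / P i) - K * (m / P i) ^ 2)) l
        (𝓝 (1 + (4 * 0 - K * 0 ^ 2))) :=
      ((hη.const_mul 4).sub ((hη.pow 2).const_mul K)).const_add 1
    have h3 : Tendsto lo l (𝓝 ((1 - K * 0 / 4) / (1 + (4 * 0 - K * 0 ^ 2)))) :=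
      h1.div h2 (by norm_num)
    norm_num at h3
    exact h3
  have hK' : Tendsto (fun i => K' * (m / P i) ^ 2 / 4) l (𝓝 0) := by
    simpa using ((hη.pow 2).const_mul K').div_const 4
  have hsmall : ∀ᶠ i in l, -1 / 2 < 4 * (m / P i) - K * (m / P i) ^ 2 := by
    have h2 : Tendsto (fun i => 4 * (m / P i) - K * (m / P i) ^ 2) l
        (𝓝 (4 * 0 - K * 0 ^ 2)) :=
      (hη.const_mul 4).sub ((hη.pow 2).const_mul K)
    exact h2.eventually_const_lt (by norm_num)
  have hTlo : ∀ᶠ i in l, lo i ≤ T i := by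
    filter_upwards [hP0, hU, hsmall] with i hPi hUi hs
    simp only [hT, hlo]
    set η := m / P i with hηi
    have hη0 : 0 < η := div_pos hm hPi
    set σ := 4 * η - K * η ^ 2 with hσ
    have h1 : 0 < 1 + σ := by linarith
    have h2 : Real.exp (-σ) ≤ 1 / (1 + σ) := by
      rw [Real.exp_neg, ← one_div]
      apply one_div_le_one_div_of_le h1
      linarith [Real.add_one_le_exp σ]
    rw [div_le_div_iff₀ h1 (by positivity)]
    have h3 : δ i ^ 2 * (1 + σ) ≤ 1 := by
      rw [← le_div_iff₀ h1]
      exact hUi.trans h2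
    have h4 : (1 - K * η / 4) * (4 * η) = σ := by rw [hσ]; ring
    linarith
  have hT1 : ∀ᶠ i in l, T i ≤ P i / p i + K' * (m / P i) ^ 2 / 4 := by
    filter_upwards [hP0, hp, hL1] with i hPi hpi h
    simp only [hT]
    rw [div_le_iff₀ (by positivity)]
    have : (P i / p i + K' * (m / P i) ^ 2 / 4) * (4 * (m / P i))
        = 4 * m / p i + K' * (m / P i) ^ 3 := by
      field_simp
    linarith
  have hT2 : ∀ᶠ i in l, T i ≤ (1 + C / P i) * (p i / P i + 1) / 2 := by
    filter_upwards [hP0, hp, hL2] with i hPi hpi h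
    simp only [hT]
    rw [div_le_iff₀ (by positivity)]
    linarith
  have hu : Tendsto (fun i => p i / P i) l (𝓝 1) := by
    have hlow : Tendsto (fun i => 2 * lo i / (1 + C / P i) - 1) l (𝓝 1) := by
      have := ((hlo1.const_mul 2).div hC one_ne_zero).sub_const 1
      norm_num at this
      exact this
    have hsub : Tendsto (fun i => lo i - K' * (m / P i) ^ 2 / 4) l (𝓝 1) := by
      simpa using hlo1.sub hK'
    have hup : Tendsto (fun i => (lo i - K' * (m / P i) ^ 2 / 4)⁻¹) l (𝓝 1) := by
      simpa using hsub.inv₀ one_ne_zero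
    refine tendsto_of_tendsto_of_tendsto_of_le_of_le' hlow hup ?_ ?_
    · filter_upwards [hTlo, hT2, hC.eventually_const_lt zero_lt_one] with i h1 h2 h3
      rw [sub_le_iff_le_add, div_le_iff₀ h3]
      linarith
    · filter_upwards [hTlo, hT1, hsub.eventually_const_lt zero_lt_one, hP0, hp]
        with i h1 h2 h3 h4 h5
      rw [← inv_div]
      exact inv_anti₀ h3 (by linarith)
  have hTlim : Tendsto T l (𝓝 1) := by
    have hup : Tendsto (fun i => P i / p i + K' * (m / P i) ^ 2 / 4) l (𝓝 1) := by
      have := (hu.inv₀ one_ne_zero).add hK'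
      simpa using this
    exact tendsto_of_tendsto_of_tendsto_of_le_of_le' hlo1 hup hTlo hT1
  have hδsq : Tendsto (fun i => δ i ^ 2) l (𝓝 1) := by
    have h1 : Tendsto (fun i => 1 - T i * (4 * (m / P i))) l (𝓝 (1 - 1 * (4 * 0))) :=
      (hTlim.mul (hη.const_mul 4)).const_sub 1
    rw [mul_zero, mul_zero, sub_zero] at h1
    refine h1.congr' ?_
    filter_upwards [hP0] with i hPi
    have : 4 * (m / P i) ≠ 0 := by positivity
    simp only [hT]
    rw [div_mul_cancel₀ _ this]
    ring
  have hδ1 : Tendsto δ l (𝓝 1) := by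
    have h1 := hδsq.sqrt
    rw [Real.sqrt_one] at h1
    refine h1.congr' ?_
    filter_upwards [hδ] with i hi
    exact Real.sqrt_sq hi
  refine ⟨isEquivalent_of_tendsto_one hu, isEquivalent_of_tendsto_one ?_⟩
  have h1 : Tendsto (fun i => 2 * T i * (p i / P i) / (1 + δ i)) l (𝓝 (2 * 1 * 1 / (1 + 1))) :=
    ((hTlim.const_mul 2).mul hu).div (hδ1.const_add 1) (by norm_num)
  norm_num at h1
  refine h1.congr' ?_
  filter_upwards [hP0, hp, hδ] with i hPi hpi hδi
  simp only [hT, Pi.div_apply]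
  have : 1 + δ i ≠ 0 := by positivity
  field_simp
  ring

theorem eventually_half_le_and_le_two_mul {ι : Type*} {l : Filter ι} {u v : ι → ℝ}
    (h : u ~[l] v) (hv : ∀ᶠ i in l, 0 < v i) :
    ∀ᶠ i in l, v i / 2 ≤ u i ∧ u i ≤ 2 * v i := by
  obtain ⟨φ, hφ, huv⟩ := h.exists_eq_mul
  filter_upwards [hφ.eventually_const_lt (show (1 / 2 : ℝ) < 1 by norm_num),
    hφ.eventually_lt_const (show (1 : ℝ) < 2 by norm_num), huv, hv] with i h1 h2 h3 h4
  rw [h3, Pi.mul_apply]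
  constructor <;> nlinarith

/-! ### The equioscillating parameter. -/

/-- The equioscillating parameter `P`, with `P³ = κ m² ν / L`. -/
noncomputable def equiParam (κ m ν L : ℝ) : ℝ := (κ * m ^ 2 * ν / L) ^ (1 / 3 : ℝ)

theorem equiParam_pos {κ m ν L : ℝ} (hκ : 0 < κ) (hm : 0 < m) (hν : 0 < ν) (hL : 0 < L) :
    0 < equiParam κ m ν L := by
  unfold equiParam; positivity

theorem equiParam_pow_three_mul {κ m ν L : ℝ} (hκ : 0 < κ) (hm : 0 < m) (hν : 0 < ν)
    (hL : 0 < L) : equiParam κ m ν L ^ 3 * L = κ * m ^ 2 * ν := by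
  have h : equiParam κ m ν L ^ 3 = κ * m ^ 2 * ν / L := by
    rw [equiParam, ← Real.rpow_natCast, ← Real.rpow_mul (by positivity)]
    norm_num
  rw [h, div_mul_cancel₀ _ hL.ne']

theorem tendsto_equiParam {κ m ν : ℝ} (hκ : 0 < κ) (hm : 0 < m) (hν : 0 < ν) :
    Tendsto (equiParam κ m ν) (𝓝[>] 0) atTop := by
  have h1 : Tendsto (fun L : ℝ => κ * m ^ 2 * ν / L) (𝓝[>] 0) atTop := by
    simp only [div_eq_mul_inv]
    exact tendsto_inv_nhdsGT_zero.const_mul_atTop (by positivity)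
  exact (tendsto_rpow_atTop (by norm_num)).comp h1

theorem equiParam_one_eq {m ν L : ℝ} (hν : 0 < ν) (hL : 0 < L) :
    equiParam 1 m ν L = equiParam 2 m ν L / (2 : ℝ) ^ (1 / 3 : ℝ) := by
  rw [equiParam, equiParam, ← Real.div_rpow (by positivity) (by norm_num)]
  congr 1
  ring

/-! ### Asymptotics of the optimum on a family of domains. -/

namespace Coeffs

theorem robinSup_equiParam_le {d : Coeffs} (hν : 0 < d.ν) (hb : 0 ≤ d.b) {E : Set (ℝ × ℝ)}
    {m κ K L P : ℝ} (hm : 0 < m) (hE : ∀ w ∈ E, m ≤ (d.z w.1 w.2).re) (hκ : 0 ≤ κ)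
    (hK : 16 ≤ K) (hP : 0 < P) (hPL : P ^ 3 * L = κ * m ^ 2 * d.ν)
    (hden : ∀ w ∈ E, 1 ≤ (d.z w.1 w.2).re / P → 1 ≤ 5 * (m / P * ((d.z w.1 w.2).re / P)) →
      (1 + (d.z w.1 w.2).re / P) ^ 2 + ((d.z w.1 w.2).im / P) ^ 2
        ≤ κ * ((d.z w.1 w.2).re / P) ^ 2 + K * ((d.z w.1 w.2).re / P)) :
    d.robinSup E L P
      ≤ ENNReal.ofReal (Real.exp (-((4 * (m / P) - K * (m / P) ^ 2) / 2))) := by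
  have hz : ∀ w ∈ E, 0 < (d.z w.1 w.2).re := fun w hw => hm.trans_le (hE w hw)
  rw [robinSup_le_iff_rhoSq (Real.exp_pos _).le hP hz]
  intro w hw
  refine (rhoSq_le_exp L hP (hz w hw)).trans ?_
  rw [← Real.exp_nat_mul]
  apply Real.exp_le_exp.2
  have him := z_im_sq_le hν hb w.1 w.2
  have hmx := hE w hw
  have hx := hz w hw
  have hden := hden w hw
  set x := (d.z w.1 w.2).re
  set y := (d.z w.1 w.2).im
  have key := le_scaled_exponent (η := m / P) (t := x / P) (s := y / P) (by positivity)
    (by gcongr) (by rw [div_pow, div_pow]; gcongr) hκ hK hden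
  have e1 : 4 * (x / P) / ((1 + x / P) ^ 2 + (y / P) ^ 2) = 4 * P * x / ((P + x) ^ 2 + y ^ 2) := by
    have : 0 < (P + x) ^ 2 + y ^ 2 := by positivity
    field_simp
  have e2 : κ * (m / P) ^ 2 * (x / P) = L * x / d.ν := by
    field_simp
    linear_combination (-1) * hPL
  rw [e1, e2] at key
  push_cast
  linarith

theorem IsRobinSol.rhoSq_le {d : Coeffs} {E : Set (ℝ × ℝ)} {L p : ℝ}
    (h : d.IsRobinSol E L p) (hp : 0 < p) (hz : ∀ w ∈ E, 0 < (d.z w.1 w.2).re)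
    (hfin : d.robinInf E L ≠ ⊤) {w : ℝ × ℝ} (hw : w ∈ E) :
    d.rhoSq L p w ≤ d.robinDelta E L ^ 2 := by
  have h1 : d.robinSup E L p ≤ ENNReal.ofReal (d.robinDelta E L) := by
    rw [robinDelta, ENNReal.ofReal_toReal hfin]
    exact h.le
  exact (robinSup_le_iff_rhoSq ENNReal.toReal_nonneg hp hz).1 h1 w hw

/-- The asymptotics of the Robin optimum on a family of domains. The parameter `κ` measures the
largest ratio `|z|² / (Re z)²` met at the interior maximum of `|ρ|`. -/
theorem isEquivalent_robin {d : Coeffs} (hν : 0 < d.ν) (hb : 0 ≤ d.b) {ι : Type*}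
    {l : Filter ι} {E : ι → Set (ℝ × ℝ)} {L p : ι → ℝ} {κ K C : ℝ} {w₁ : ℝ × ℝ}
    (hm : 0 < (d.z w₁.1 w₁.2).re) (hκ : 0 < κ) (hK : 16 ≤ K) (hC : 0 ≤ C)
    (hL : Tendsto L l (𝓝[>] 0))
    (hE : ∀ i, ∀ w ∈ E i, (d.z w₁.1 w₁.2).re ≤ (d.z w.1 w.2).re) (hw₁ : ∀ᶠ i in l, w₁ ∈ E i)
    (hp : ∀ᶠ i in l, 0 < p i ∧ d.IsRobinSol (E i) (L i) (p i))
    (hden : ∀ᶠ i in l, ∀ P, P = equiParam κ (d.z w₁.1 w₁.2).re d.ν (L i) →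
      ∀ w ∈ E i, 1 ≤ (d.z w.1 w.2).re / P →
      1 ≤ 5 * ((d.z w₁.1 w₁.2).re / P * ((d.z w.1 w.2).re / P)) →
      (1 + (d.z w.1 w.2).re / P) ^ 2 + ((d.z w.1 w.2).im / P) ^ 2
        ≤ κ * ((d.z w.1 w.2).re / P) ^ 2 + K * ((d.z w.1 w.2).re / P))
    (htest : ∀ᶠ i in l, ∀ X, X = 2 * equiParam κ (d.z w₁.1 w₁.2).re d.ν (L i) ^ 2
        / (κ * (d.z w₁.1 w₁.2).re) →
      ∃ w ∈ E i, κ * X ^ 2 ≤ (d.z w.1 w.2).re ^ 2 + (d.z w.1 w.2).im ^ 2 ∧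
        (d.z w.1 w.2).re ≤ X + C) :
    p ~[l] (fun i => equiParam κ (d.z w₁.1 w₁.2).re d.ν (L i)) ∧
    (fun i => 1 - d.robinDelta (E i) (L i))
      ~[l] fun i => 4 * (d.z w₁.1 w₁.2).re / (2 * p i) := by
  set m := (d.z w₁.1 w₁.2).re with hmdef
  set P : ι → ℝ := fun i => equiParam κ m d.ν (L i) with hPdef
  have hP : Tendsto P l atTop := (tendsto_equiParam hκ hm hν).comp hL
  have hL0 : ∀ᶠ i in l, 0 < L i := hL.eventually self_mem_nhdsWithin
  have hz : ∀ i, ∀ w ∈ E i, 0 < (d.z w.1 w.2).re := fun i w hw => hm.trans_le (hE i w hw)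
  have hUsup : ∀ᶠ i in l, d.robinInf (E i) (L i) ≤ ENNReal.ofReal
      (Real.exp (-((4 * (m / P i) - K * (m / P i) ^ 2) / 2))) := by
    filter_upwards [hL0, hden] with i hLi hdi
    exact (iInf_le _ _).trans (robinSup_equiParam_le hν hb hm (hE i) hκ.le hK
      (equiParam_pos hκ hm hν hLi) (equiParam_pow_three_mul hκ hm hν hLi) (hdi _ rfl))
  have hfin : ∀ᶠ i in l, d.robinInf (E i) (L i) ≠ ⊤ := by
    filter_upwards [hUsup] with i hi
    exact (lt_of_le_of_lt hi ENNReal.ofReal_lt_top).ne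
  -- At the lowest frequency the overlap contributes `Lm/ν = κ (m/P)³`. At the test frequency the
  -- relative error is `C/X = Cκm/(2P²)`, weakened to order `1/P`.
  refine isEquivalent_of_equioscillation (K := K) (K' := κ) (C := C * (κ * m / 2)) hm hP
    (hp.mono fun i hi => hi.1) (Eventually.of_forall fun i => ENNReal.toReal_nonneg) ?_ ?_ ?_
  · filter_upwards [hUsup] with i hi
    have h1 : d.robinDelta (E i) (L i)
        ≤ Real.exp (-((4 * (m / P i) - K * (m / P i) ^ 2) / 2)) :=
      ENNReal.toReal_le_of_le_ofReal (Real.exp_pos _).le hi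
    have h0 : 0 ≤ d.robinDelta (E i) (L i) := ENNReal.toReal_nonneg
    calc d.robinDelta (E i) (L i) ^ 2
        ≤ Real.exp (-((4 * (m / P i) - K * (m / P i) ^ 2) / 2)) ^ 2 := by gcongr
      _ = _ := by rw [← Real.exp_nat_mul]; congr 1; push_cast; ring
  · filter_upwards [hL0, hp, hw₁, hfin] with i hLi hpi hwi hfi
    refine le_trans ?_ (hpi.2.rhoSq_le hpi.1 (hz i) hfi hwi)
    refine le_trans ?_ (le_rhoSq hν hLi.le hpi.1 hm)
    have hPi : 0 < P i := equiParam_pos hκ hm hν hLi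
    have hPL : P i ^ 3 * L i = κ * m ^ 2 * d.ν := equiParam_pow_three_mul hκ hm hν hLi
    have e1 : κ * (m / P i) ^ 3 = L i * m / d.ν := by
      field_simp
      linear_combination (-1) * hPL
    have e2 : 4 * p i * m / ((p i + m) ^ 2 + (d.z w₁.1 w₁.2).im ^ 2) ≤ 4 * m / p i := by
      have hpi := hpi.1
      rw [div_le_div_iff₀ (by positivity) hpi]
      have : p i ^ 2 ≤ (p i + m) ^ 2 + (d.z w₁.1 w₁.2).im ^ 2 := by
        nlinarith [mul_pos hpi hm, sq_nonneg (d.z w₁.1 w₁.2).im]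
      calc 4 * p i * m * p i = 4 * m * p i ^ 2 := by ring
        _ ≤ _ := by gcongr
    rw [e1, ← hmdef]
    linarith
  · filter_upwards [hL0, hp, htest, hfin, hP.eventually_ge_atTop 1] with i hLi hpi hti hfi hPi1
    obtain ⟨w, hw, hzX, hxX⟩ := hti _ rfl
    refine le_trans ?_ (hpi.2.rhoSq_le hpi.1 (hz i) hfi hw)
    refine le_trans ?_ (le_rhoSq hν hLi.le hpi.1 (hz i w hw))
    have hpi := hpi.1
    have hx := hz i w hw
    have hPi : 0 < P i := equiParam_pos hκ hm hν hLi
    have hPL : P i ^ 3 * L i = κ * m ^ 2 * d.ν := equiParam_pow_three_mul hκ hm hν hLi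
    change κ * (2 * P i ^ 2 / (κ * m)) ^ 2 ≤ _ at hzX
    change _ ≤ 2 * P i ^ 2 / (κ * m) + C at hxX
    set x := (d.z w.1 w.2).re
    set y := (d.z w.1 w.2).im
    set Q := P i
    set X := 2 * Q ^ 2 / (κ * m) with hX
    have hX0 : 0 < X := by positivity
    have hCX : C / X ≤ C * (κ * m / 2) / Q := by
      have : C / X = C * (κ * m / 2) / Q ^ 2 := by
        rw [hX]; field_simp
      rw [this]
      gcongr
      nlinarith
    have e1 : 4 * p i * x / ((p i + x) ^ 2 + y ^ 2) ≤ 2 * (m / Q) * (p i / Q) * (1 + C / X) := by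
      calc 4 * p i * x / ((p i + x) ^ 2 + y ^ 2) ≤ 4 * p i * (X + C) / (κ * X ^ 2) := by
            apply div_le_div₀ (by positivity) (by gcongr) (by positivity)
            nlinarith [mul_pos hpi hx]
        _ = 4 * p i / (κ * X) * (1 + C / X) := by field_simp
        _ = 2 * (m / Q) * (p i / Q) * (1 + C / X) := by
            congr 1
            rw [hX]; field_simp; ring
    have e2 : L i * x / d.ν ≤ 2 * (m / Q) * (1 + C / X) := by
      calc L i * x / d.ν ≤ L i * (X + C) / d.ν := by gcongr
        _ = L i * X / d.ν * (1 + C / X) := by field_simp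
        _ = 2 * (m / Q) * (1 + C / X) := by
            congr 1
            rw [hX]; field_simp
            linear_combination hPL
    calc 1 - 2 * (m / Q) * (1 + C * (κ * m / 2) / Q) * (p i / Q + 1)
        ≤ 1 - 2 * (m / Q) * (1 + C / X) * (p i / Q + 1) := by gcongr
      _ ≤ _ := by linarith

theorem one_add_sq_add_sq_le {d : Coeffs} (hν : 0 < d.ν) (hb : 0 ≤ d.b) {P : ℝ}
    (w : ℝ × ℝ) (ht : 1 ≤ (d.z w.1 w.2).re / P) :
    (1 + (d.z w.1 w.2).re / P) ^ 2 + ((d.z w.1 w.2).im / P) ^ 2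
      ≤ 2 * ((d.z w.1 w.2).re / P) ^ 2 + 16 * ((d.z w.1 w.2).re / P) := by
  have h : ((d.z w.1 w.2).im / P) ^ 2 ≤ ((d.z w.1 w.2).re / P) ^ 2 := by
    rw [div_pow, div_pow]
    have := z_im_sq_le hν hb w.1 w.2
    gcongr
  nlinarith

/-- For small overlap the Robin problem is uniquely solvable on every domain that contains the
frequency of smallest `Re z`, uniformly in the domain. -/
theorem eventually_exists_isUniqueRobinSol {d : Coeffs} (hν : 0 < d.ν) (hb : 0 ≤ d.b)
    {ωm km : ℝ} (hωm : 0 ≤ ωm) (hkm : 0 ≤ km)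
    (hnd : d.x0sq + 4 * d.ν ^ 2 * km ^ 2 ≠ 0 ∨ ωm ≠ 0) {w₁ : ℝ × ℝ}
    (hw₁ : w₁ ∈ freqDomainInf ωm km)
    (hmin : ∀ w ∈ freqDomainInf ωm km, (d.z w₁.1 w₁.2).re ≤ (d.z w.1 w.2).re) :
    ∀ᶠ L : ℝ in 𝓝[>] 0, ∀ E : Set (ℝ × ℝ), IsClosed E → (∀ w ∈ E, -w ∈ E) →
      E ⊆ freqDomainInf ωm km → w₁ ∈ E → ∃ p : ℝ, 0 < p ∧ d.IsUniqueRobinSol E L p := by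
  have hm := z_re_pos hν hb hωm hkm hnd hw₁
  have hη : Tendsto (fun L => (d.z w₁.1 w₁.2).re / equiParam 2 (d.z w₁.1 w₁.2).re d.ν L)
      (𝓝[>] 0) (𝓝 0) := (tendsto_equiParam two_pos hm hν).const_div_atTop _
  filter_upwards [self_mem_nhdsWithin,
    hη.eventually_lt_const (show (0 : ℝ) < 1 / 16 by norm_num)] with L hL hη1 E hE hsym hsub hwE
  have hL : 0 < L := hL
  have hP := equiParam_pos two_pos hm hν hL
  have hPL := equiParam_pow_three_mul two_pos hm hν hL
  refine exists_isUniqueRobinSol hν hb hE hsym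
    ((z_continuousOn hν hb hωm hkm hnd).mono hsub)
    (fun w hw => z_re_pos hν hb hωm hkm hnd (hsub hw)) hL hwE
    (p₀ := (equiParam 2 (d.z w₁.1 w₁.2).re d.ν L : ℝ))
    (lt_of_le_of_lt (robinSup_equiParam_le hν hb hm (fun w hw => hmin w (hsub hw))
      zero_le_two le_rfl hP hPL fun w _ ht _ => one_add_sq_add_sq_le hν hb w ht) ?_)
  rw [ENNReal.ofReal_lt_ofReal_iff (Real.exp_pos _)]
  apply Real.exp_lt_exp.2
  apply neg_lt_neg
  set m := (d.z w₁.1 w₁.2).re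
  set P := equiParam 2 m d.ν L
  have hη0 : 0 < m / P := by positivity
  -- For small `η = m/P` the overlap damping at `w₁` is only `exp(-η³)`, whereas `P` achieves
  -- `exp(-(2η - 8η²))`.
  have e : L * m / (2 * d.ν) = (m / P) ^ 3 := by
    field_simp
    linear_combination hPL
  rw [e]
  set η := m / P
  nlinarith [mul_pos hη0 hη0, mul_pos (mul_pos hη0 hη0) hη0]

/-! ### Test frequencies near the interior maximum. -/

/-- Along `k = km`, a frequency with `Re z ≈ Im z ≈ X`. -/
theorem exists_freq_of_sq_eq (d : Coeffs) (hν : 0 < d.ν) (hb : 0 ≤ d.b) (km : ℝ) {X : ℝ}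
    (hX : 0 < X) :
    2 * X ^ 2 ≤ (d.z (X ^ 2 / (2 * d.ν) - d.c * km) km).re ^ 2
        + (d.z (X ^ 2 / (2 * d.ν) - d.c * km) km).im ^ 2 ∧
      (d.z (X ^ 2 / (2 * d.ν) - d.c * km) km).re
        ≤ X + √(d.x0sq + 4 * d.ν ^ 2 * km ^ 2) := by
  have h1 := d.z_re_sq_sub_im_sq (X ^ 2 / (2 * d.ν) - d.c * km) km
  have h2 := d.z_re_mul_im (X ^ 2 / (2 * d.ν) - d.c * km) km
  have h3 := d.z_re_nonneg (X ^ 2 / (2 * d.ν) - d.c * km) km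
  have hB : 0 ≤ d.x0sq + 4 * d.ν ^ 2 * km ^ 2 := by
    have := x0sq_nonneg hν hb
    positivity
  rw [sub_add_cancel, mul_div_cancel₀ _ (by positivity)] at h2
  set x := (d.z (X ^ 2 / (2 * d.ν) - d.c * km) km).re
  set y := (d.z (X ^ 2 / (2 * d.ν) - d.c * km) km).im
  set B := d.x0sq + 4 * d.ν ^ 2 * km ^ 2
  refine ⟨by nlinarith [sq_nonneg (x - y)], ?_⟩
  by_contra hcon
  push Not at hcon
  have hs := Real.sq_sqrt hB
  have hs0 := Real.sqrt_nonneg B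
  have hx2 : (X + √B) ^ 2 < x ^ 2 := by gcongr
  have hy2 : X ^ 2 ≤ y ^ 2 := by nlinarith [mul_nonneg hX.le hs0]
  have hxX : X ^ 2 < x ^ 2 := by nlinarith [mul_nonneg hX.le hs0]
  have h4 : x ^ 2 * y ^ 2 = X ^ 2 * X ^ 2 := by
    rw [← mul_pow, h2]
    ring
  have hX2 : 0 < X ^ 2 := by positivity
  have h5 : X ^ 2 * X ^ 2 < x ^ 2 * y ^ 2 :=
    mul_lt_mul hxX hy2 hX2 (sq_nonneg x)
  linarith

/-- Along `ω = ωm`, a frequency with `Re z ≈ X` and bounded `Im z`. -/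
theorem exists_freq_of_eq (d : Coeffs) (hν : 0 < d.ν) (hb : 0 ≤ d.b) {ωm : ℝ} (hωm : 0 ≤ ωm)
    {X : ℝ} (hX : 1 ≤ X) :
    1 * X ^ 2 ≤ (d.z ωm (X / (2 * d.ν))).re ^ 2 + (d.z ωm (X / (2 * d.ν))).im ^ 2 ∧
      (d.z ωm (X / (2 * d.ν))).re ≤ X + √(d.x0sq + (2 * d.ν * ωm + |d.c|) ^ 2) := by
  have h1 := d.z_re_sq_sub_im_sq ωm (X / (2 * d.ν))
  have h2 := d.z_re_mul_im ωm (X / (2 * d.ν))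
  have h3 := d.z_re_nonneg ωm (X / (2 * d.ν))
  have hx0 := x0sq_nonneg hν hb
  rw [show d.x0sq + 4 * d.ν ^ 2 * (X / (2 * d.ν)) ^ 2 = d.x0sq + X ^ 2 by field_simp; ring]
    at h1
  rw [show 2 * d.ν * (ωm + d.c * (X / (2 * d.ν))) = 2 * d.ν * ωm + d.c * X by field_simp] at h2
  set x := (d.z ωm (X / (2 * d.ν))).re
  set y := (d.z ωm (X / (2 * d.ν))).im
  set c₀ := 2 * d.ν * ωm + |d.c| with hc₀
  have hc₀0 : 0 ≤ c₀ := by positivity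
  refine ⟨by nlinarith [sq_nonneg y], ?_⟩
  have hxX : X ≤ x := by
    apply le_of_sq_le_sq _ h3
    nlinarith [sq_nonneg y]
  have hXy : X * |y| ≤ X * c₀ := by
    calc X * |y| ≤ x * |y| := by gcongr
      _ = |2 * d.ν * ωm + d.c * X| := by rw [← h2, abs_mul, abs_of_nonneg h3]
      _ ≤ |2 * d.ν * ωm| + |d.c * X| := abs_add_le _ _
      _ = 2 * d.ν * ωm * 1 + |d.c| * X := by
        rw [abs_mul d.c, abs_of_nonneg (by positivity : 0 ≤ 2 * d.ν * ωm),
          abs_of_pos (by linarith : 0 < X), mul_one]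
      _ ≤ 2 * d.ν * ωm * X + |d.c| * X := by gcongr
      _ = X * c₀ := by rw [hc₀]; ring
  have hy : |y| ≤ c₀ := le_of_mul_le_mul_left hXy (by linarith)
  have hy2 : y ^ 2 ≤ c₀ ^ 2 := by
    rw [← sq_abs y]
    gcongr
  have hB : 0 ≤ d.x0sq + c₀ ^ 2 := by positivity
  apply le_of_sq_le_sq _ (by positivity)
  have hs := Real.sq_sqrt hB
  nlinarith [mul_nonneg (by linarith : 0 ≤ X) (Real.sqrt_nonneg (d.x0sq + c₀ ^ 2))]

open Classical in
/-- The real solution of the Robin problem, when it is uniquely solvable. -/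
noncomputable def robinParam (d : Coeffs) (E : Set (ℝ × ℝ)) (L : ℝ) : ℝ :=
  if h : ∃ p : ℝ, 0 < p ∧ d.IsUniqueRobinSol E L p then h.choose else 0

theorem robinParam_spec {d : Coeffs} {E : Set (ℝ × ℝ)} {L : ℝ}
    (h : ∃ p : ℝ, 0 < p ∧ d.IsUniqueRobinSol E L p) :
    0 < d.robinParam E L ∧ d.IsUniqueRobinSol E L (d.robinParam E L) := by
  rw [robinParam, dif_pos h]
  exact h.choose_spec

end Coeffs

/-! ### Which frequencies the grid sees. -/

theorem tendsto_pi_div_atTop {ι : Type*} {l : Filter ι} {u : ι → ℝ}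
    (hu : Tendsto u l (𝓝[>] 0)) : Tendsto (fun i => Real.pi / u i) l atTop := by
  simp only [div_eq_mul_inv]
  exact (tendsto_inv_nhdsGT_zero.comp hu).const_mul_atTop Real.pi_pos

theorem eventually_mem_freqDomain {ι : Type*} {l : Filter ι} {h Δt : ι → ℝ}
    (hh : Tendsto h l (𝓝[>] 0)) (hΔt : Tendsto Δt l (𝓝[>] 0)) {ωm km : ℝ} {w : ℝ × ℝ}
    (hw : w ∈ freqDomainInf ωm km) : ∀ᶠ i in l, w ∈ freqDomain ωm km (h i) (Δt i) := by
  filter_upwards [(tendsto_pi_div_atTop hh).eventually_ge_atTop |w.2|,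
    (tendsto_pi_div_atTop hΔt).eventually_ge_atTop |w.1|] with i h1 h2
  exact ⟨hw.1, h2, hw.2, h1⟩

theorem eventually_mul_equiParam_pow_le {ι : Type*} {l : Filter ι} {h L : ι → ℝ}
    (hh : ∀ᶠ i in l, 0 < h i) {CL κ m ν : ℝ} (hCL : 0 < CL) (hκ : 0 < κ) (hm : 0 < m)
    (hν : 0 < ν) (hL : L ~[l] fun i => CL * h i) :
    ∀ᶠ i in l, CL / (2 * κ * m ^ 2 * ν) * equiParam κ m ν (L i) ^ 3 ≤ 1 / h i := by
  have hpos : ∀ᶠ i in l, 0 < CL * h i := hh.mono fun i hi => mul_pos hCL hi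
  filter_upwards [hh, eventually_half_le_and_le_two_mul hL hpos] with i hi hLi
  have hLpos : 0 < L i := lt_of_lt_of_le (by positivity) hLi.1
  have hP := equiParam_pow_three_mul hκ hm hν hLpos
  have e : equiParam κ m ν (L i) ^ 3 = κ * m ^ 2 * ν / L i := by
    rw [← hP, mul_div_cancel_right₀ _ hLpos.ne']
  rw [e, show CL / (2 * κ * m ^ 2 * ν) * (κ * m ^ 2 * ν / L i) = CL / (2 * L i) by field_simp,
    div_le_div_iff₀ (by positivity) hi]
  linarith [hLi.1]

/-- The frequencies seen by the grid have bounded `Re z · Im z` relative to `P³ / Re z₁` when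
`Δt` and `h` are comparable, so that `Im z` is negligible at the interior maximum. -/
theorem Coeffs.one_add_sq_add_sq_le_of_mem_freqDomain {d : Coeffs} (hν : 0 < d.ν)
    {ωm km h Δt L CL Ch m P : ℝ} (hm : 0 < m) (hh : 0 < h) (hCL : 0 < CL) (hCh : 0 < Ch)
    (hL0 : 0 < L) (hL : L ≤ 2 * (CL * h)) (hΔt : Ch * h / 2 ≤ Δt) (hP : 0 < P)
    (hPL : P ^ 3 * L = 1 * m ^ 2 * d.ν) {w : ℝ × ℝ} (hw : w ∈ freqDomain ωm km h Δt)
    (ht : 1 ≤ (d.z w.1 w.2).re / P) (ht' : 1 ≤ 5 * (m / P * ((d.z w.1 w.2).re / P))) :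
    (1 + (d.z w.1 w.2).re / P) ^ 2 + ((d.z w.1 w.2).im / P) ^ 2
      ≤ 1 * ((d.z w.1 w.2).re / P) ^ 2
        + (16 + 25 * (2 * Real.pi / m * (4 * CL / Ch + |d.c| * (2 * CL))) ^ 2)
          * ((d.z w.1 w.2).re / P) := by
  have hxy := d.z_re_mul_im w.1 w.2
  set x := (d.z w.1 w.2).re
  set y := (d.z w.1 w.2).im
  set C := 2 * Real.pi / m * (4 * CL / Ch + |d.c| * (2 * CL)) with hC
  have hΔt0 : 0 < Δt := lt_of_lt_of_le (by positivity) hΔt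
  have hπ := Real.pi_pos
  have hfreq : |w.1 + d.c * w.2| ≤ Real.pi / Δt + |d.c| * (Real.pi / h) := by
    refine (abs_add_le _ _).trans ?_
    rw [abs_mul]
    obtain ⟨-, h1, -, h2⟩ := hw
    gcongr
  -- Since `xy = 2ν(ω + ck)` is at most of order `1/L`, this product is bounded; as `m x / P² ≥
  -- 1/5`, so is `y / P`.
  have e : m / P * (x / P) * (y / P) = L * (x * y) / (m * d.ν) := by
    field_simp
    linear_combination (-x * y) * hPL
  have hbd : |m / P * (x / P) * (y / P)| ≤ C := by
    rw [e, hxy, show L * (2 * d.ν * (w.1 + d.c * w.2)) / (m * d.ν)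
      = 2 * L / m * (w.1 + d.c * w.2) by field_simp, abs_mul,
      abs_of_pos (by positivity : 0 < 2 * L / m)]
    have h1 : L / Δt ≤ 4 * CL / Ch := by
      rw [div_le_div_iff₀ hΔt0 hCh]
      nlinarith
    have h2 : L / h ≤ 2 * CL := by
      rw [div_le_iff₀ hh]
      linarith
    calc 2 * L / m * |w.1 + d.c * w.2|
        ≤ 2 * L / m * (Real.pi / Δt + |d.c| * (Real.pi / h)) := by gcongr
      _ = 2 * Real.pi / m * (L / Δt + |d.c| * (L / h)) := by ring
      _ ≤ C := by rw [hC]; gcongr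
  set t := x / P
  set s := y / P
  have hηt : 0 ≤ m / P * t := by nlinarith
  have hs : |s| ≤ 5 * C := by
    rw [abs_mul, abs_of_nonneg hηt] at hbd
    nlinarith [abs_nonneg s]
  have hs2 : s ^ 2 ≤ 25 * C ^ 2 := by
    rw [← sq_abs s]
    nlinarith [abs_nonneg s]
  nlinarith [mul_nonneg (sq_nonneg C) (sub_nonneg.2 ht)]

theorem tendsto_const_mul_equiParam_sq {m ν κ : ℝ} (hκ : 0 < κ) (hm : 0 < m) (hν : 0 < ν) :
    Tendsto (fun L => 2 * equiParam κ m ν L ^ 2 / (κ * m)) (𝓝[>] 0) atTop :=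
  (((tendsto_pow_atTop two_ne_zero).comp (tendsto_equiParam hκ hm hν)).const_mul_atTop
    two_pos).atTop_div_const (by positivity)

theorem eventually_mem_freqDomainInf {ν : ℝ} (hν : 0 < ν) (c km : ℝ) {ωm : ℝ} (hωm : 0 ≤ ωm) :
    ∀ᶠ X : ℝ in atTop, 0 < X ∧ 0 ≤ X ^ 2 / (2 * ν) - c * km ∧
      (X ^ 2 / (2 * ν) - c * km, km) ∈ freqDomainInf ωm km := by
  have hlim : Tendsto (fun X : ℝ => X ^ 2 / (2 * ν)) atTop atTop :=
    (tendsto_pow_atTop two_ne_zero).atTop_div_const (by positivity)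
  filter_upwards [hlim.eventually_ge_atTop (ωm + c * km), eventually_gt_atTop 0] with X h1 h2
  refine ⟨h2, by linarith, ?_, le_abs_self _⟩
  exact le_trans (by linarith) (le_abs_self _)

/-- When `Δt` is of order `h²`, the grid sees the interior maximum at `k = km`. -/
theorem Coeffs.eventually_exists_freq_of_sq {d : Coeffs} (hν : 0 < d.ν) (hb : 0 ≤ d.b)
    {ωm km : ℝ} (hωm : 0 ≤ ωm) (hkm : 0 ≤ km) {m CL Ch : ℝ} (hm : 0 < m) (hCL : 0 < CL)
    (hCh : 0 < Ch) {ι : Type*} {l : Filter ι} {h Δt L : ι → ℝ} (hh : Tendsto h l (𝓝[>] 0))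
    (hΔt : Tendsto Δt l (𝓝[>] 0)) (hL : Tendsto L l (𝓝[>] 0)) (hLh : L ~[l] fun i => CL * h i)
    (hΔ : Δt ~[l] fun i => Ch * h i ^ 2) :
    ∀ᶠ i in l, ∀ X, X = 2 * equiParam 2 m d.ν (L i) ^ 2 / (2 * m) →
      ∃ w ∈ freqDomain ωm km (h i) (Δt i),
        2 * X ^ 2 ≤ (d.z w.1 w.2).re ^ 2 + (d.z w.1 w.2).im ^ 2 ∧
        (d.z w.1 w.2).re ≤ X + √(d.x0sq + 4 * d.ν ^ 2 * km ^ 2) := by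
  have hπ := Real.pi_pos
  have hh0 : ∀ᶠ i in l, 0 < h i := hh.eventually self_mem_nhdsWithin
  have hΔt0 : ∀ᶠ i in l, 0 < Δt i := hΔt.eventually self_mem_nhdsWithin
  have hP : Tendsto (fun i => equiParam 2 m d.ν (L i)) l atTop :=
    (tendsto_equiParam two_pos hm hν).comp hL
  set a := CL / (2 * 2 * m ^ 2 * d.ν) with ha
  have ha0 : 0 < a := by positivity
  set b := Real.pi * a ^ 2 / (2 * Ch) with hbdef
  have hb0 : 0 < b := by positivity
  set g := 1 / (2 * d.ν * m ^ 2) + |d.c| * km with hg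
  have hCh2 : ∀ᶠ i in l, 0 < Ch * h i ^ 2 := hh0.mono fun i hi => by positivity
  filter_upwards [((tendsto_const_mul_equiParam_sq two_pos hm hν).comp hL).eventually
      (eventually_mem_freqDomainInf hν d.c km hωm), hΔt0, hh0,
    eventually_half_le_and_le_two_mul hΔ hCh2, (tendsto_pi_div_atTop hh).eventually_ge_atTop km,
    eventually_mul_equiParam_pow_le hh0 hCL two_pos hm hν hLh,
    hP.eventually_ge_atTop 1, hP.eventually_ge_atTop (g / b)]
    with i hX hΔi hhi hΔb hkmi hinv hP1 hPg X hXeq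
  simp only [Function.comp_apply, ← hXeq] at hX
  set P := equiParam 2 m d.ν (L i)
  refine ⟨(X ^ 2 / (2 * d.ν) - d.c * km, km), ⟨hX.2.2.1, ?_, hX.2.2.2, ?_⟩, d.exists_freq_of_sq_eq hν hb km hX.1⟩
  · simp only [abs_of_nonneg hX.2.1]
    rw [div_le_iff₀ hb0] at hPg
    -- The test frequency has `ω` of order `X²`, hence `P⁴`, while the cutoff `π/Δt` is at least of
    -- order `h⁻²`, hence `P⁶`.
    have h1 : g * P ^ 4 ≤ b * P ^ 6 := by
      have h4 : P ^ 4 ≤ P ^ 5 := pow_le_pow_right₀ hP1 (by norm_num)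
      have hg0 : 0 ≤ g := by positivity
      calc g * P ^ 4 ≤ g * P ^ 5 := by gcongr
        _ ≤ P * b * P ^ 5 := by gcongr
        _ = b * P ^ 6 := by ring
    have h2 : X ^ 2 / (2 * d.ν) - d.c * km ≤ g * P ^ 4 := by
      have e1 : X ^ 2 / (2 * d.ν) = 1 / (2 * d.ν * m ^ 2) * P ^ 4 := by
        rw [hXeq]; field_simp
      have e2 : -(d.c * km) ≤ |d.c| * km := by
        rw [← neg_mul]; gcongr; exact neg_le_abs _
      have e3 : |d.c| * km * 1 ≤ |d.c| * km * P ^ 4 := by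
        gcongr
        exact one_le_pow₀ hP1
      rw [e1, hg, add_mul]
      linarith
    have h3 : b * P ^ 6 ≤ Real.pi / Δt i := by
      have h5 : (a * P ^ 3) ^ 2 ≤ (1 / h i) ^ 2 := by gcongr
      calc b * P ^ 6 = Real.pi / (2 * Ch) * (a * P ^ 3) ^ 2 := by rw [hbdef]; ring
        _ ≤ Real.pi / (2 * Ch) * (1 / h i) ^ 2 := by gcongr
        _ = Real.pi / (2 * (Ch * h i ^ 2)) := by field_simp
        _ ≤ Real.pi / Δt i := by
          gcongr
          exact hΔb.2
    linarith
  · simpa [abs_of_nonneg hkm] using hkmi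

/-- When `Δt` is of order `h`, the grid sees the interior maximum at `|ω| = ωm`. -/
theorem Coeffs.eventually_exists_freq_of_linear {d : Coeffs} (hν : 0 < d.ν) (hb : 0 ≤ d.b)
    {ωm km : ℝ} (hωm : 0 ≤ ωm) {m CL : ℝ} (hm : 0 < m) (hCL : 0 < CL)
    {ι : Type*} {l : Filter ι} {h Δt L : ι → ℝ} (hh : Tendsto h l (𝓝[>] 0))
    (hΔt : Tendsto Δt l (𝓝[>] 0)) (hL : Tendsto L l (𝓝[>] 0))
    (hLh : L ~[l] fun i => CL * h i) :
    ∀ᶠ i in l, ∀ X, X = 2 * equiParam 1 m d.ν (L i) ^ 2 / (1 * m) →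
      ∃ w ∈ freqDomain ωm km (h i) (Δt i),
        1 * X ^ 2 ≤ (d.z w.1 w.2).re ^ 2 + (d.z w.1 w.2).im ^ 2 ∧
        (d.z w.1 w.2).re ≤ X + √(d.x0sq + (2 * d.ν * ωm + |d.c|) ^ 2) := by
  have hπ := Real.pi_pos
  have hh0 : ∀ᶠ i in l, 0 < h i := hh.eventually self_mem_nhdsWithin
  have hP : Tendsto (fun i => equiParam 1 m d.ν (L i)) l atTop :=
    (tendsto_equiParam one_pos hm hν).comp hL
  set a := CL / (2 * 1 * m ^ 2 * d.ν) with ha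
  have ha0 : 0 < a := by positivity
  have hXl := (tendsto_const_mul_equiParam_sq one_pos hm hν).comp hL
  filter_upwards [hXl.eventually_ge_atTop 1, hXl.eventually_ge_atTop (2 * d.ν * km), hh0,
    (tendsto_pi_div_atTop hΔt).eventually_ge_atTop ωm,
    eventually_mul_equiParam_pow_le hh0 hCL one_pos hm hν hLh,
    hP.eventually_ge_atTop (1 / (m * d.ν * (Real.pi * a)))]
    with i hX1 hXkm hhi hωi hinv hPg X hXeq
  simp only [Function.comp_apply, ← hXeq] at hX1 hXkm
  have hX0 : 0 < X := by linarith
  set P := equiParam 1 m d.ν (L i)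
  have hXν : 0 < X / (2 * d.ν) := by positivity
  refine ⟨(ωm, X / (2 * d.ν)), ⟨?_, ?_, ?_, ?_⟩, d.exists_freq_of_eq hν hb hωm hX1⟩
  · exact le_abs_self _
  · simpa [abs_of_nonneg hωm] using hωi
  · simp only [abs_of_pos hXν]
    rw [le_div_iff₀ (by positivity)]
    linarith
  · simp only [abs_of_pos hXν]
    rw [div_le_iff₀ (by positivity)] at hPg
    -- The test frequency has `k` of order `P²`, below the cutoff `π/h`, which is at least of order
    -- `P³`.
    calc X / (2 * d.ν) = P ^ 2 / (m * d.ν) * 1 := by rw [hXeq]; field_simp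
      _ ≤ P ^ 2 / (m * d.ν) * (P * (m * d.ν * (Real.pi * a))) := by gcongr
      _ = Real.pi * (a * P ^ 3) := by field_simp
      _ ≤ Real.pi * (1 / h i) := by gcongr
      _ = Real.pi / h i := by ring

end SchwarzWR

/-! ### The theorem. -/

open SchwarzWR SchwarzWR.Coeffs in
theorem theorem2p3 (d : SchwarzWR.Coeffs) (hν : 0 < d.ν) (hb : 0 ≤ d.b)
    (ωm km : ℝ) (hωm : 0 ≤ ωm) (hkm : 0 ≤ km)
    (hnd : d.x0sq + 4 * d.ν ^ 2 * km ^ 2 ≠ 0 ∨ ωm ≠ 0) :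
    -- the minimizer `p*_{0,∞}(L)` on the unbounded domain is well defined for small `L > 0`
    ∃ pInf : ℝ → ℝ,
      (∀ᶠ L : ℝ in 𝓝[>] 0,
        d.IsUniqueRobinSol (SchwarzWR.freqDomainInf ωm km) L (pInf L : ℂ)) ∧
      -- `h`, `Δt` and `L` depend on a parameter `i`, with `h, Δt → 0⁺` and `L ∼ CL h`
      ∀ {ι : Type*} (l : Filter ι) (h Δt L : ι → ℝ),
        Tendsto h l (𝓝[>] 0) → Tendsto Δt l (𝓝[>] 0) →
        ∀ CL : ℝ, 0 < CL → L ~[l] (fun i => CL * h i) →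
        ∃ pStar : ι → ℝ,
          (∀ᶠ i in l, d.IsUniqueRobinSol (SchwarzWR.freqDomain ωm km (h i) (Δt i)) (L i)
            (pStar i : ℂ)) ∧
          (∀ Ch : ℝ, 0 < Ch → Δt ~[l] (fun i => Ch * h i ^ 2) →
            pStar ~[l] (fun i => pInf (L i)) ∧
            (fun i => 1 - d.robinDelta (SchwarzWR.freqDomain ωm km (h i) (Δt i)) (L i))
              ~[l] (fun i => d.constA ωm km / (2 * pStar i))) ∧
          (∀ Ch : ℝ, 0 < Ch → Δt ~[l] (fun i => Ch * h i) →
            pStar ~[l] (fun i => pInf (L i) / (2 : ℝ) ^ (1 / 3 : ℝ)) ∧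
            (fun i => 1 - d.robinDelta (SchwarzWR.freqDomain ωm km (h i) (Δt i)) (L i))
              ~[l] (fun i => d.constA ωm km / (2 * pStar i))) := by
  obtain ⟨w₁, hw₁, hA, hmin⟩ := exists_isMin_re hν hb hωm hkm hnd
  have hm := z_re_pos hν hb hωm hkm hnd hw₁
  rw [hA]
  have hsolv := eventually_exists_isUniqueRobinSol hν hb hωm hkm hnd hw₁ hmin
  set m := (d.z w₁.1 w₁.2).re with hmdef
  have hspecInf : ∀ᶠ L : ℝ in 𝓝[>] 0, 0 < d.robinParam (freqDomainInf ωm km) L ∧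
      d.IsUniqueRobinSol (freqDomainInf ωm km) L (d.robinParam (freqDomainInf ωm km) L) := by
    filter_upwards [hsolv] with L hLs
    exact robinParam_spec (hLs _ (isClosed_freqDomainInf _ _)
      (fun _ => neg_mem_freqDomainInf) subset_rfl hw₁)
  -- The unbounded problem fits the same asymptotic lemma, with a constant family of domains indexed
  -- by `L` itself.
  have hInf : (d.robinParam (freqDomainInf ωm km)) ~[𝓝[>] 0] equiParam 2 m d.ν := by
    refine (isEquivalent_robin hν hb (E := fun _ => freqDomainInf ωm km) (L := id) (K := 16)
      hm two_pos le_rfl (Real.sqrt_nonneg (d.x0sq + 4 * d.ν ^ 2 * km ^ 2)) tendsto_id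
      (fun _ => hmin) (Eventually.of_forall fun _ => hw₁)
      (hspecInf.mono fun L h => ⟨h.1, h.2.1⟩)
      (Eventually.of_forall fun _ P _ w _ ht _ => one_add_sq_add_sq_le hν hb w ht) ?_).1
    filter_upwards [(tendsto_const_mul_equiParam_sq two_pos hm hν).eventually
      (eventually_mem_freqDomainInf hν d.c km hωm)] with L hL X hX
    subst hX
    exact ⟨_, hL.2.2, d.exists_freq_of_sq_eq hν hb km hL.1⟩
  refine ⟨d.robinParam (freqDomainInf ωm km), hspecInf.mono fun _ h => h.2, ?_⟩
  intro ι l h Δt L hh hΔt CL hCL hLh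
  have hh0 : ∀ᶠ i in l, 0 < h i := hh.eventually self_mem_nhdsWithin
  have hCLh : ∀ᶠ i in l, 0 < CL * h i := hh0.mono fun i hi => mul_pos hCL hi
  have hLbd := eventually_half_le_and_le_two_mul hLh hCLh
  have hL0 : ∀ᶠ i in l, 0 < L i := by
    filter_upwards [hLbd, hCLh] with i h1 h2
    linarith
  have hL : Tendsto L l (𝓝[>] 0) := by
    refine tendsto_nhdsWithin_iff.2 ⟨?_, hL0⟩
    have h1 : Tendsto (fun i => CL * h i) l (𝓝 (CL * 0)) :=
      (tendsto_nhdsWithin_iff.1 hh).1.const_mul CL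
    rw [mul_zero] at h1
    exact hLh.symm.tendsto_nhds h1
  have hw₁D := eventually_mem_freqDomain hh hΔt hw₁
  have hspec : ∀ᶠ i in l, 0 < d.robinParam (freqDomain ωm km (h i) (Δt i)) (L i) ∧
      d.IsUniqueRobinSol (freqDomain ωm km (h i) (Δt i)) (L i)
        (d.robinParam (freqDomain ωm km (h i) (Δt i)) (L i)) := by
    filter_upwards [hL.eventually hsolv, hw₁D] with i hLs hw
    exact robinParam_spec (hLs _ (isClosed_freqDomain _ _ _ _) (fun _ => neg_mem_freqDomain)
      (freqDomain_subset _ _ _ _) hw)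
  have hsol := hspec.mono fun i h => And.intro h.1 h.2.1
  have hminD : ∀ i, ∀ w ∈ freqDomain ωm km (h i) (Δt i), m ≤ (d.z w.1 w.2).re :=
    fun i w hw => hmin w (freqDomain_subset _ _ _ _ hw)
  have hInfL : (fun i => d.robinParam (freqDomainInf ωm km) (L i))
      ~[l] fun i => equiParam 2 m d.ν (L i) := hInf.comp_tendsto hL
  refine ⟨fun i => d.robinParam (freqDomain ωm km (h i) (Δt i)) (L i),
    hspec.mono fun _ h => h.2, fun Ch hCh hΔ => ?_, fun Ch hCh hΔ => ?_⟩
  · obtain ⟨hp, hδ⟩ := isEquivalent_robin hν hb (E := fun i => freqDomain ωm km (h i) (Δt i))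
      (K := 16) hm two_pos le_rfl (Real.sqrt_nonneg (d.x0sq + 4 * d.ν ^ 2 * km ^ 2)) hL
      hminD hw₁D hsol
      (Eventually.of_forall fun _ P _ w _ ht _ => one_add_sq_add_sq_le hν hb w ht)
      (eventually_exists_freq_of_sq hν hb hωm hkm hm hCL hCh hh hΔt hL hLh hΔ)
    exact ⟨hp.trans hInfL.symm, hδ⟩
  · have hChh : ∀ᶠ i in l, 0 < Ch * h i := hh0.mono fun i hi => by positivity
    obtain ⟨hp, hδ⟩ := isEquivalent_robin hν hb (E := fun i => freqDomain ωm km (h i) (Δt i))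
      (K := 16 + 25 * (2 * Real.pi / m * (4 * CL / Ch + |d.c| * (2 * CL))) ^ 2) hm one_pos
      (le_add_of_nonneg_right (by positivity))
      (Real.sqrt_nonneg (d.x0sq + (2 * d.ν * ωm + |d.c|) ^ 2)) hL hminD hw₁D hsol (by
        filter_upwards [hh0, hL0, hLbd, eventually_half_le_and_le_two_mul hΔ hChh]
          with i hhi hLi hLb hΔb P hPeq w hw ht ht'
        subst hPeq
        exact one_add_sq_add_sq_le_of_mem_freqDomain hν hm hhi hCL hCh hLi hLb.2 hΔb.1
          (equiParam_pos one_pos hm hν hLi) (equiParam_pow_three_mul one_pos hm hν hLi)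
          hw ht ht')
      (eventually_exists_freq_of_linear hν hb hωm hm hCL hh hΔt hL hLh)
    refine ⟨hp.trans ?_, hδ⟩
    have h1 : (fun i => d.robinParam (freqDomainInf ωm km) (L i) / (2 : ℝ) ^ (1 / 3 : ℝ))
        ~[l] fun i => equiParam 2 m d.ν (L i) / (2 : ℝ) ^ (1 / 3 : ℝ) :=
      hInfL.div IsEquivalent.refl
    refine IsEquivalent.trans (EventuallyEq.isEquivalent ?_) h1.symm
    filter_upwards [hL0] with i hLi
    exact equiParam_one_eq hν hLi
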